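/- Let $N\subset M$ be factors of type III on a separable Hilbert space, and let $\iota:N\hookrightarrow M$ be the embedding. For unital $*$-homomorphisms $\varphi_1,\varphi_2:A\to B$ put $\mathrm{Hom}(\varphi_1,\varphi_2)=\{t\in B: t\varphi_1(a)=\varphi_2(a)t\ \forall a\in A\}$, with composition $t_2\circ t_1=t_2t_1$ and monoidal product $t_2\times t_1=t_2\,\varphi_2(t_1)$ for $t_1\in\mathrm{Hom}(\varphi_1,\varphi_3)$, $t_2\in\mathrm{Hom}(\varphi_2,\varphi_4)$. Suppose that $\iota$ has finite dimension: let $\bar\iota:M\to N$ be a conjugate homomorphism, $\theta=\bar\iota\iota$ and $\gamma=\iota\bar\iota$, and let $w\in\mathrm{Hom}(\mathrm{id}_N,\theta)$, $v\in\mathrm{Hom}(\mathrm{id}_M,\gamma)$ be a standard solution of the conjugacy relations $\iota(w^*)v=1$, $\bar\iota(v^*)w=1$; that is, $w^*w=d\cdot 1$ and $v^*v=d\cdot 1$ with $d$ the smallest value that occurs for normalized solutions of the conjugacy relations for $\iota$. Put $x=\bar\iota(v)\in\mathrm{Hom}(\theta,\theta^2)$; the Q-system of $N\subset M$ is $Q=(\theta,w,x)$.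 Let $$\chi(t)=v^*\iota(t)\gamma(v),\qquad \chi^{-1}(s)=\theta(w^*)\bar\iota(s)w$$ be the Fourier transformation $\mathrm{Hom}(\theta,\theta)\to\mathrm{Hom}(\gamma,\gamma)$ and its inverse, and let $t_1\ast t_2=\chi^{-1}(\chi(t_1)\circ\chi(t_2))$ be the convolution product on $\mathrm{Hom}(\theta,\theta)$. 1. The algebra $[\mathrm{Hom}(\theta,\theta),\ast]$ is commutative if and only if $[\mathrm{Hom}(\gamma,\gamma),\circ]$ is commutative. 2. If $[\mathrm{Hom}(\gamma,\gamma),\circ]$ is commutative, then $\gamma$ is multiplicity-free: $\gamma\simeq\bigoplus_a\gamma_a$, a finite direct sum of irreducible, pairwise unitarily inequivalent endomorphisms $\gamma_a$ of $M$. 3. Suppose that $\theta$ belongs to a full tensor subcategory of $\mathrm{End}_0(N)$ (the tensor category of endomorphisms of $N$ with finite dimension) that has a unitary braiding $\varepsilon$, and that $Q$ is commutative, i.e. $\varepsilon_{\theta,\theta}\circ x=x$. Then $[\mathrm{Hom}(\theta,\theta),\ast]$ is commutative, $[\mathrm{Hom}(\gamma,\gamma),\circ]$ is commutative, and $\gamma$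 is multiplicity-free. -/

import Mathlib

namespace Subfactor

/-! ## Intertwiners between unital `*`-homomorphisms -/

section Intertwiners

variable {A B C : Type*}
  [Ring A] [StarRing A] [Algebra ℂ A]
  [Ring B] [StarRing B] [Algebra ℂ B]
  [Ring C] [StarRing C] [Algebra ℂ C]

/-- `Hom φ₁ φ₂ = {t ∈ B : t φ₁(a) = φ₂(a) t for all a ∈ A}`. -/
def Hom (φ₁ φ₂ : A →⋆ₐ[ℂ] B) : Submodule ℂ B where
  carrier := {t | ∀ a, t * φ₁ a = φ₂ a * t}
  add_mem' := by
    intro s t hs ht a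
    rw [add_mul, mul_add, hs a, ht a]
  zero_mem' := by
    intro a
    rw [zero_mul, mul_zero]
  smul_mem' := by
    intro c t ht a
    rw [smul_mul_assoc, mul_smul_comm, ht a]

/-- The unit intertwiner `1_φ ∈ Hom(φ, φ)`. -/
def one (φ : A →⋆ₐ[ℂ] B) : Hom φ φ :=
  ⟨1, fun a => by rw [one_mul, mul_one]⟩

/-- The adjoint `t* ∈ Hom(φ₂, φ₁)` of `t ∈ Hom(φ₁, φ₂)`. -/
def adj {φ₁ φ₂ : A →⋆ₐ[ℂ] B} (t : Hom φ₁ φ₂) : Hom φ₂ φ₁ :=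
  ⟨star (t : B), fun a => by
    have h := congrArg star (t.2 (star a))
    simpa [star_mul, map_star] using h.symm⟩

/-- The concatenation product `t₂ ∘ t₁ = t₂ t₁`. -/
def comp {φ₁ φ₂ φ₃ : A →⋆ₐ[ℂ] B} (t₂ : Hom φ₂ φ₃) (t₁ : Hom φ₁ φ₂) : Hom φ₁ φ₃ :=
  ⟨(t₂ : B) * (t₁ : B), fun a => by
    rw [mul_assoc, t₁.2 a, ← mul_assoc, t₂.2 a, mul_assoc]⟩

/-- The monoidal product `t₂ × t₁ = t₂ φ₂(t₁) ∈ Hom(φ₂φ₁, φ₄φ₃)` of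
`t₂ ∈ Hom(φ₂, φ₄)` and `t₁ ∈ Hom(φ₁, φ₃)`. -/
def tens {φ₁ φ₃ : A →⋆ₐ[ℂ] B} {φ₂ φ₄ : B →⋆ₐ[ℂ] C} (t₂ : Hom φ₂ φ₄) (t₁ : Hom φ₁ φ₃) :
    Hom (φ₂.comp φ₁) (φ₄.comp φ₃) :=
  ⟨(t₂ : C) * φ₂ (t₁ : B), fun a => by
    change (t₂ : C) * φ₂ (t₁ : B) * φ₂ (φ₁ a) = φ₄ (φ₃ a) * ((t₂ : C) * φ₂ (t₁ : B))
    rw [mul_assoc, ← map_mul, t₁.2 a, map_mul, ← mul_assoc, t₂.2 (φ₃ a), mul_assoc]⟩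

/-- `s × 1_ψ = s` as elements. -/
theorem coe_tens_one (ψ : A →⋆ₐ[ℂ] B) {φ₂ φ₄ : B →⋆ₐ[ℂ] C} (s : Hom φ₂ φ₄) :
    (tens s (one ψ) : C) = (s : C) := by
  change (s : C) * φ₂ 1 = s
  rw [map_one, mul_one]

/-- `1_ψ × t = ψ(t)` as elements. -/
theorem coe_one_tens {φ₁ φ₃ : A →⋆ₐ[ℂ] B} (ψ : B →⋆ₐ[ℂ] C) (t : Hom φ₁ φ₃) :
    (tens (one ψ) t : C) = ψ (t : B) := by
  change (1 : C) * ψ (t : B) = ψ (t : B)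
  rw [one_mul]

/-- `φ` is irreducible: `Hom(φ, φ) = ℂ · 1` (and `B` is not the zero ring). -/
def IsIrreducible (φ : A →⋆ₐ[ℂ] B) : Prop :=
  Nontrivial B ∧ ∀ t : Hom φ φ, ∃ c : ℂ, t = c • one φ

/-- Unitary equivalence of homomorphisms. -/
def IsEquivalent (φ₁ φ₂ : A →⋆ₐ[ℂ] B) : Prop :=
  ∃ u : Hom φ₁ φ₂, comp (adj u) u = one φ₁ ∧ comp u (adj u) = one φ₂

/-- `φ ≃ ⨁ᵢ φᵢ`: there are isometries `tᵢ` with `∑ᵢ tᵢ tᵢ* = 1` and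
`φ = ∑ᵢ tᵢ φᵢ(·) tᵢ*`. -/
def IsDirectSum {n : ℕ} (φ : A →⋆ₐ[ℂ] B) (φs : Fin n → (A →⋆ₐ[ℂ] B)) : Prop :=
  ∃ t : Fin n → B, (∀ i, star (t i) * t i = 1) ∧ (∑ i, t i * star (t i) = 1) ∧
    ∀ a, φ a = ∑ i, t i * φs i a * star (t i)

/-- `φ` is a finite direct sum of irreducible, pairwise inequivalent homomorphisms. -/
def IsMultiplicityFree (φ : A →⋆ₐ[ℂ] B) : Prop :=
  ∃ (n : ℕ) (φs : Fin n → (A →⋆ₐ[ℂ] B)), IsDirectSum φ φs ∧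
    (∀ i, IsIrreducible (φs i)) ∧ ∀ i j, i ≠ j → ¬ IsEquivalent (φs i) (φs j)

/-! ## Conjugates and dimension -/

/-- The conjugacy relations
`(1_φ × r*) ∘ (r̄ × 1_φ) = 1` and `(1_φ̄ × r̄*) ∘ (r × 1_φ̄) = 1` for
`r ∈ Hom(id_A, φ̄φ)` and `r̄ ∈ Hom(id_B, φφ̄)`, written as equations
`φ(r*) r̄ = 1` in `B` and `φ̄(r̄*) r = 1` in `A`. -/
def ConjugacyRelations (φ : A →⋆ₐ[ℂ] B) (φbar : B →⋆ₐ[ℂ] A)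
    (r : Hom (StarAlgHom.id ℂ A) (φbar.comp φ)) (rbar : Hom (StarAlgHom.id ℂ B) (φ.comp φbar)) :
    Prop :=
  φ (star (r : A)) * (rbar : B) = 1 ∧ φbar (star (rbar : B)) * (r : A) = 1

/-- The normalization `r* ∘ r = d · 1_A`, `r̄* ∘ r̄ = d · 1_B`. -/
def IsNormalized {φ : A →⋆ₐ[ℂ] B} {φbar : B →⋆ₐ[ℂ] A}
    (r : Hom (StarAlgHom.id ℂ A) (φbar.comp φ)) (rbar : Hom (StarAlgHom.id ℂ B) (φ.comp φbar))
    (d : ℝ) : Prop :=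
  comp (adj r) r = (d : ℂ) • one (StarAlgHom.id ℂ A) ∧
    comp (adj rbar) rbar = (d : ℂ) • one (StarAlgHom.id ℂ B)

/-- All numbers `d` that occur for normalized solutions of the conjugacy relations for `φ`;
the dimension of `φ` is the infimum of this set. -/
def dimensionValues (φ : A →⋆ₐ[ℂ] B) : Set ℝ :=
  {d | ∃ (φbar : B →⋆ₐ[ℂ] A) (r : Hom (StarAlgHom.id ℂ A) (φbar.comp φ))
    (rbar : Hom (StarAlgHom.id ℂ B) (φ.comp φbar)),
    ConjugacyRelations φ φbar r rbar ∧ IsNormalized r rbar d}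

/-- A standard solution of the conjugacy relations: a normalized one whose `d` is the least
possible. -/
def IsStandardSolution (φ : A →⋆ₐ[ℂ] B) (φbar : B →⋆ₐ[ℂ] A)
    (r : Hom (StarAlgHom.id ℂ A) (φbar.comp φ)) (rbar : Hom (StarAlgHom.id ℂ B) (φ.comp φbar)) :
    Prop :=
  ConjugacyRelations φ φbar r rbar ∧
    ∃ d : ℝ, IsNormalized r rbar d ∧ IsLeast (dimensionValues φ) d

/-- `φ` has finite dimension: it has a normalized solution of the conjugacy relations. -/
def HasFiniteDimension (φ : A →⋆ₐ[ℂ] B) : Prop := (dimensionValues φ).Nonempty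

/-! ## Braided full subcategories of `End₀(A)` -/

/-- A full tensor subcategory of the strict tensor `*`-category `End₀(A)` of endomorphisms with
finite dimension (arrows: intertwiners; tensor product: composition), given by its set of
objects, together with a unitary braiding `ε`. -/
structure BraidedFullSubcategory (A : Type*) [Ring A] [StarRing A] [Algebra ℂ A] where
  obj : Set (A →⋆ₐ[ℂ] A)
  finiteDimension : ∀ ρ ∈ obj, HasFiniteDimension ρ
  id_mem : StarAlgHom.id ℂ A ∈ obj
  comp_mem : ∀ ρ ∈ obj, ∀ σ ∈ obj, ρ.comp σ ∈ obj
  /-- `ε_{ρ,σ} ∈ Hom(ρσ, σρ)` -/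
  ε : ∀ ρ σ : obj, Hom (ρ.1.comp σ.1) (σ.1.comp ρ.1)
  adj_comp : ∀ ρ σ : obj, comp (adj (ε ρ σ)) (ε ρ σ) = one (ρ.1.comp σ.1)
  comp_adj : ∀ ρ σ : obj, comp (ε ρ σ) (adj (ε ρ σ)) = one (σ.1.comp ρ.1)
  naturality : ∀ (ρ ρ' σ σ' : obj) (s : Hom ρ.1 ρ'.1) (t : Hom σ.1 σ'.1),
    comp (ε ρ' σ') (tens s t) = comp (tens t s) (ε ρ σ)
  /-- `ε_{ρσ,τ} = (ε_{ρ,τ} × 1_σ) ∘ (1_ρ × ε_{σ,τ})` -/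
  hexagon_left : ∀ ρ σ τ : obj,
    (ε ⟨ρ.1.comp σ.1, comp_mem ρ.1 ρ.2 σ.1 σ.2⟩ τ : A) = (ε ρ τ : A) * ρ.1 (ε σ τ : A)
  /-- `ε_{ρ,στ} = (1_σ × ε_{ρ,τ}) ∘ (ε_{ρ,σ} × 1_τ)` -/
  hexagon_right : ∀ ρ σ τ : obj,
    (ε ρ ⟨σ.1.comp τ.1, comp_mem σ.1 σ.2 τ.1 τ.2⟩ : A) = σ.1 (ε ρ τ : A) * (ε ρ σ : A)

/-! ## Canonical endomorphisms, Fourier transformation, convolution, Q-system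

Here `ι : A → B`, `ιbar : B → A`, `w ∈ Hom(id_A, ιbar ι)` and `v ∈ Hom(id_B, ι ιbar)`. -/

/-- The canonical endomorphism `γ = ι ιbar` of `B`. -/
abbrev canonicalEnd (ι : A →⋆ₐ[ℂ] B) (ιbar : B →⋆ₐ[ℂ] A) : B →⋆ₐ[ℂ] B := ι.comp ιbar

/-- The dual canonical endomorphism `θ = ιbar ι` of `A`. -/
abbrev dualCanonicalEnd (ι : A →⋆ₐ[ℂ] B) (ιbar : B →⋆ₐ[ℂ] A) : A →⋆ₐ[ℂ] A := ιbar.comp ι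

variable {ι : A →⋆ₐ[ℂ] B} {ιbar : B →⋆ₐ[ℂ] A}

/-- The Fourier transformation
`χ(t) = (v* × 1_γ) ∘ (1_ι × t × 1_ιbar) ∘ (1_γ × v) = v* ι(t) γ(v)`. -/
def fourier (v : Hom (StarAlgHom.id ℂ B) (canonicalEnd ι ιbar))
    (t : Hom (dualCanonicalEnd ι ιbar) (dualCanonicalEnd ι ιbar)) :
    Hom (canonicalEnd ι ιbar) (canonicalEnd ι ιbar) :=
  ⟨star (v : B) * (ι (t : A) * canonicalEnd ι ιbar (v : B)), fun b => by
    have h₁ : (v : B) * b = ι (ιbar b) * v := v.2 b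
    have h₂ : (t : A) * ιbar (ι (ιbar b)) = ιbar (ι (ιbar b)) * t := t.2 (ιbar b)
    have h₃ : star (v : B) * ι (ιbar (ι (ιbar b))) = ι (ιbar b) * star (v : B) :=
      (adj v).2 (ι (ιbar b))
    change star (v : B) * (ι (t : A) * ι (ιbar (v : B))) * ι (ιbar b) =
      ι (ιbar b) * (star (v : B) * (ι (t : A) * ι (ιbar (v : B))))
    calc star (v : B) * (ι (t : A) * ι (ιbar (v : B))) * ι (ιbar b)
        = star (v : B) * (ι (t : A) * ι (ιbar ((v : B) * b))) := by
          simp only [map_mul, mul_assoc]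
      _ = star (v : B) * (ι ((t : A) * ιbar (ι (ιbar b))) * ι (ιbar (v : B))) := by
          rw [h₁]; simp only [map_mul, mul_assoc]
      _ = star (v : B) * ι (ιbar (ι (ιbar b))) * (ι (t : A) * ι (ιbar (v : B))) := by
          rw [h₂]; simp only [map_mul, mul_assoc]
      _ = ι (ιbar b) * (star (v : B) * (ι (t : A) * ι (ιbar (v : B)))) := by
          rw [h₃, mul_assoc]⟩

/-- The inverse Fourier transformation
`χ⁻¹(s) = (1_θ × w*) ∘ (1_ιbar × s × 1_ι) ∘ (w × 1_θ) = θ(w*) ιbar(s) w`. -/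
def fourierInv (w : Hom (StarAlgHom.id ℂ A) (dualCanonicalEnd ι ιbar))
    (s : Hom (canonicalEnd ι ιbar) (canonicalEnd ι ιbar)) :
    Hom (dualCanonicalEnd ι ιbar) (dualCanonicalEnd ι ιbar) :=
  ⟨dualCanonicalEnd ι ιbar (star (w : A)) * (ιbar (s : B) * (w : A)), fun a => by
    have h₁ : (w : A) * ιbar (ι a) = ιbar (ι (ιbar (ι a))) * w := w.2 (ιbar (ι a))
    have h₂ : (s : B) * ι (ιbar (ι a)) = ι (ιbar (ι a)) * s := s.2 (ι a)
    have h₃ : star (w : A) * ιbar (ι a) = a * star (w : A) := (adj w).2 a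
    change ιbar (ι (star (w : A))) * (ιbar (s : B) * (w : A)) * ιbar (ι a) =
      ιbar (ι a) * (ιbar (ι (star (w : A))) * (ιbar (s : B) * (w : A)))
    calc ιbar (ι (star (w : A))) * (ιbar (s : B) * (w : A)) * ιbar (ι a)
        = ιbar (ι (star (w : A))) * (ιbar ((s : B) * ι (ιbar (ι a))) * (w : A)) := by
          rw [mul_assoc, mul_assoc, h₁]; simp only [map_mul, mul_assoc]
      _ = ιbar (ι (star (w : A) * ιbar (ι a))) * (ιbar (s : B) * (w : A)) := by
          rw [h₂]; simp only [map_mul, mul_assoc]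
      _ = ιbar (ι a) * (ιbar (ι (star (w : A))) * (ιbar (s : B) * (w : A))) := by
          rw [h₃]; simp only [map_mul, mul_assoc]⟩

/-- The convolution product `t₁ ∗ t₂ = χ⁻¹(χ(t₁) ∘ χ(t₂))` on `Hom(θ, θ)`. -/
def convolution (w : Hom (StarAlgHom.id ℂ A) (dualCanonicalEnd ι ιbar))
    (v : Hom (StarAlgHom.id ℂ B) (canonicalEnd ι ιbar))
    (t₁ t₂ : Hom (dualCanonicalEnd ι ιbar) (dualCanonicalEnd ι ιbar)) :
    Hom (dualCanonicalEnd ι ιbar) (dualCanonicalEnd ι ιbar) :=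
  fourierInv w (comp (fourier v t₁) (fourier v t₂))

/-- The third entry `x = ιbar(v) ∈ Hom(θ, θ²)` of the Q-system `Q = (θ, w, x)`. -/
def qComult (v : Hom (StarAlgHom.id ℂ B) (canonicalEnd ι ιbar)) :
    Hom (dualCanonicalEnd ι ιbar)
      ((dualCanonicalEnd ι ιbar).comp (dualCanonicalEnd ι ιbar)) :=
  ⟨ιbar (v : B), fun a => by
    change ιbar (v : B) * ιbar (ι a) = ιbar (ι (ιbar (ι a))) * ιbar (v : B)
    rw [← map_mul, ← map_mul]
    exact congrArg ιbar (v.2 (ι a))⟩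

/-- The Q-system `(θ, w, x)` is commutative with respect to the braiding of `𝒞 ∋ θ`:
`ε_{θ,θ} ∘ x = x`. -/
def IsCommutativeQSystem (𝒞 : BraidedFullSubcategory A)
    (hθ : dualCanonicalEnd ι ιbar ∈ 𝒞.obj)
    (v : Hom (StarAlgHom.id ℂ B) (canonicalEnd ι ιbar)) : Prop :=
  comp (𝒞.ε ⟨dualCanonicalEnd ι ιbar, hθ⟩ ⟨dualCanonicalEnd ι ιbar, hθ⟩) (qComult v) = qComult v

end Intertwiners

/-! ## Type III factors -/

section Factors

variable {H : Type*} [NormedAddCommGroup H] [InnerProductSpace ℂ H] [CompleteSpace H]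

/-- A von Neumann algebra on `H ≠ 0` with center `ℂ · 1`. -/
def IsFactor (M : VonNeumannAlgebra H) : Prop :=
  Nontrivial H ∧ ∀ z ∈ M, z ∈ M.commutant → ∃ c : ℂ, z = c • (1 : H →L[ℂ] H)

/-- The projection `p` is infinite in `M`: it is Murray-von Neumann equivalent in `M` to a
proper subprojection of itself. -/
def IsInfiniteProjection (M : VonNeumannAlgebra H) (p : H →L[ℂ] H) : Prop :=
  ∃ u ∈ M, star u * u = p ∧ p * (u * star u) = u * star u ∧ u * star u ≠ p

/-- A factor of type III: every nonzero projection is infinite. -/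
def IsTypeIIIFactor (M : VonNeumannAlgebra H) : Prop :=
  IsFactor M ∧ ∀ p ∈ M, IsStarProjection p → p ≠ 0 → IsInfiniteProjection M p

/-- The embedding homomorphism `N ↪ M`. -/
noncomputable def embedding {N M : VonNeumannAlgebra H} (h : N ≤ M) :
    N.toStarSubalgebra →⋆ₐ[ℂ] M.toStarSubalgebra :=
  StarSubalgebra.inclusion (S₁ := N.toStarSubalgebra) (S₂ := M.toStarSubalgebra) h

end Factors

end Subfactor

/-! The conjugacy relations make `fourier` and `fourierInv` mutually inverse, so convolution is
composition on Hom(γ,γ) transported along a bijection; this gives the equivalence of the two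
commutativities (`convolution_comm_iff`).

For a commutative Q-system, the key identity is χ(x*(t₁ × t₂)x) = χ(t₂)χ(t₁)
(`fourier_qComult_conj`), so a convolution product is x*(t₂ × t₁)x. Inserting ε*ε = 1, naturality
exchanges the two factors and x = εx absorbs the braiding on both sides.

Multiplicity-freeness needs a decomposition of γ into irreducibles. The element R = ι(w)v solves the
conjugacy relations for the self-conjugate γ with R*R = d², and this bounds the length of any
orthogonal family of nonzero self-adjoint elements of Hom(γ,γ) by d⁴ (`card_orthogonal_le`). When
Hom(γ,γ) is commutative, an orthogonal positive family of maximal length consists of multiples of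
minimal projections with sum 1 (`exists_minimal_projections`). In a type III factor on a separable
space every nonzero projection is tt* for an isometry t (`IsTypeIIIFactor.exists_isometry_onto`), so
each minimal projection yields an irreducible compression t*γ(·)t. An equivalence between two
different compressions would give a nonzero element of Hom(γ,γ) that maps one minimal projection to
another, which commutativity forbids (`isMultiplicityFree_of_minimal`). -/

namespace Subfactor

/-! ### Fourier transformation, convolution, and the commutative Q-system. -/

section Fourier

variable {A B : Type*}
  [Ring A] [StarRing A] [Algebra ℂ A] [Ring B] [StarRing B] [Algebra ℂ B]
  {ι : A →⋆ₐ[ℂ] B} {ιbar : B →⋆ₐ[ℂ] A}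
  {w : Hom (StarAlgHom.id ℂ A) (dualCanonicalEnd ι ιbar)}
  {v : Hom (StarAlgHom.id ℂ B) (canonicalEnd ι ιbar)}

/-- With ι and ῑ exchanged, this and the next lemma apply to w as well, because θ is the canonical
endomorphism of the exchanged pair. -/
theorem coe_mul_eq (v : Hom (StarAlgHom.id ℂ B) (canonicalEnd ι ιbar)) (b : B) :
    (v : B) * b = ι (ιbar b) * v := v.2 b

theorem star_coe_mul_eq (v : Hom (StarAlgHom.id ℂ B) (canonicalEnd ι ιbar)) (b : B) :
    star (v : B) * ι (ιbar b) = b * star (v : B) := (adj v).2 b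

theorem ConjugacyRelations.symm (h : ConjugacyRelations ι ιbar w v) :
    ConjugacyRelations ιbar ι v w := ⟨h.2, h.1⟩

theorem ConjugacyRelations.star_mul_map (h : ConjugacyRelations ι ιbar w v) :
    star (v : B) * ι (w : A) = 1 := by
  have := congrArg star h.1
  simpa [map_star] using this

theorem ConjugacyRelations.star_mul_map' (h : ConjugacyRelations ι ιbar w v) :
    star (w : A) * ιbar (v : B) = 1 := h.symm.star_mul_map

/-- The intertwining properties of v, w and s bring the outer v* next to ι(w) and w* next to ῑ(v);
both pairs are 1 by the adjoint conjugacy relations. -/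
theorem fourier_fourierInv (h : ConjugacyRelations ι ιbar w v)
    (s : Hom (canonicalEnd ι ιbar) (canonicalEnd ι ιbar)) :
    fourier v (fourierInv w s) = s := by
  apply Subtype.ext
  have hs : (s : B) * ι (ιbar (v : B)) = ι (ιbar (v : B)) * s := s.2 v
  change star (v : B) * (ι (ιbar (ι (star (w : A))) * (ιbar (s : B) * (w : A))) *
    ι (ιbar (v : B))) = s
  calc _ = star (v : B) * ι (ιbar (ι (star (w : A)) * s)) * ι ((w : A) * ιbar (v : B)) := by
        simp only [map_mul, mul_assoc]
    _ = ι (star (w : A)) * s * (star (v : B) * ι (ιbar (ι (ιbar (v : B))))) * ι (w : A) := by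
        rw [star_coe_mul_eq v, coe_mul_eq w]; simp only [map_mul, mul_assoc]
    _ = ι (star (w : A)) * (s * ι (ιbar (v : B))) * (star (v : B) * ι (w : A)) := by
        rw [star_coe_mul_eq v]; simp only [mul_assoc]
    _ = ι (star (w : A) * ιbar (v : B)) * s := by
        rw [hs, h.star_mul_map, mul_one, map_mul, mul_assoc]
    _ = s := by rw [h.star_mul_map', map_one, one_mul]

theorem fourierInv_fourier (h : ConjugacyRelations ι ιbar w v)
    (t : Hom (dualCanonicalEnd ι ιbar) (dualCanonicalEnd ι ιbar)) :
    fourierInv w (fourier v t) = t := by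
  apply Subtype.ext
  have ht : (t : A) * ιbar (ι (star (w : A))) = ιbar (ι (star (w : A))) * t := t.2 _
  change ιbar (ι (star (w : A))) * (ιbar (star (v : B) * (ι (t : A) * ι (ιbar (v : B)))) *
    (w : A)) = t
  calc _ = ιbar (ι (star (w : A))) * ιbar (star (v : B)) *
        (ιbar (ι ((t : A) * ιbar (v : B))) * (w : A)) := by
        simp only [map_mul, mul_assoc]
    _ = ιbar (ι (star (w : A))) * (ιbar (star (v : B)) * (w : A)) * (t * ιbar (v : B)) := by
        rw [← coe_mul_eq w]; simp only [mul_assoc]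
    _ = t * ιbar (ι (star (w : A)) * (v : B)) := by
        rw [h.2, mul_one, ← mul_assoc, ← ht, map_mul, mul_assoc]
    _ = t := by rw [h.1, map_one, mul_one]

theorem convolution_comm_iff (h : ConjugacyRelations ι ιbar w v) :
    (∀ t₁ t₂ : Hom (dualCanonicalEnd ι ιbar) (dualCanonicalEnd ι ιbar),
      convolution w v t₁ t₂ = convolution w v t₂ t₁) ↔
    ∀ s₁ s₂ : Hom (canonicalEnd ι ιbar) (canonicalEnd ι ιbar), comp s₁ s₂ = comp s₂ s₁ := by
  refine ⟨fun H s₁ s₂ => ?_, fun H t₁ t₂ => congrArg (fourierInv w) (H _ _)⟩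
  have := congrArg (fourier v) (H (fourierInv w s₁) (fourierInv w s₂))
  simpa only [convolution, fourier_fourierInv h] using this

/-- `χ(x* ∘ (t₁ × t₂) ∘ x) = χ(t₂) ∘ χ(t₁)`. -/
theorem fourier_qComult_conj (v : Hom (StarAlgHom.id ℂ B) (canonicalEnd ι ιbar))
    (t₁ t₂ : Hom (dualCanonicalEnd ι ιbar) (dualCanonicalEnd ι ιbar)) :
    fourier v (comp (adj (qComult v)) (comp (tens t₁ t₂) (qComult v))) =
      comp (fourier v t₂) (fourier v t₁) := by
  apply Subtype.ext
  have h₁ : (fourier v t₁ : B) * ι (ιbar (v : B)) = ι (ιbar (v : B)) * (fourier v t₁ : B) :=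
    (fourier v t₁).2 v
  have h₂ : (t₁ : A) * ιbar (ι (t₂ : A)) = ιbar (ι (t₂ : A)) * t₁ := t₁.2 _
  -- Coassociativity: this is the image under γ of γ(v)v = vv.
  have h₃ : ι (ιbar (ι (ιbar (v : B)))) * ι (ιbar (v : B)) = ι (ιbar (v : B)) * ι (ιbar (v : B)) := by
    simp only [← map_mul, ← coe_mul_eq v]
  change star (v : B) * (ι (star (ιbar (v : B)) * (((t₁ : A) * ιbar (ι (t₂ : A))) *
      ιbar (v : B))) * ι (ιbar (v : B))) =
    star (v : B) * (ι (t₂ : A) * ι (ιbar (v : B))) * (fourier v t₁ : B)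
  calc _ = star (v : B) * ι (ιbar (star (v : B))) * ι (ιbar (ι (t₂ : A))) * ι (t₁ : A) *
        (ι (ιbar (v : B)) * ι (ιbar (v : B))) := by
        rw [h₂]; simp only [map_mul, map_star, mul_assoc]
    _ = star (v : B) * (star (v : B) * ι (ιbar (ι (t₂ : A)))) * ι (t₁ : A) *
        (ι (ιbar (ι (ιbar (v : B)))) * ι (ιbar (v : B))) := by
        rw [star_coe_mul_eq v, h₃]; simp only [mul_assoc]
    _ = star (v : B) * ι (t₂ : A) * (star (v : B) * ι ((t₁ : A) * ιbar (ι (ιbar (v : B))))) *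
        ι (ιbar (v : B)) := by
        rw [star_coe_mul_eq v]; simp only [map_mul, mul_assoc]
    _ = star (v : B) * ι (t₂ : A) * ((star (v : B) * (ι (t₁ : A) * ι (ιbar (v : B)))) *
        ι (ιbar (v : B))) := by
        rw [map_mul]
        simp only [mul_assoc, h₃]
    _ = star (v : B) * ι (t₂ : A) * ((fourier v t₁ : B) * ι (ιbar (v : B))) := rfl
    _ = _ := by rw [h₁]; simp only [mul_assoc]

/-- The factors appear in reverse order, which is harmless for commutativity. -/
theorem convolution_eq_qComult_conj (h : ConjugacyRelations ι ιbar w v)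
    (t₁ t₂ : Hom (dualCanonicalEnd ι ιbar) (dualCanonicalEnd ι ιbar)) :
    convolution w v t₁ t₂ = comp (adj (qComult v)) (comp (tens t₂ t₁) (qComult v)) := by
  rw [convolution, ← fourier_qComult_conj, fourierInv_fourier h]

/-- In x*(t₂ × t₁)x insert ε*ε = 1 after x*. The left ε* is absorbed into x*, naturality carries ε
past t₂ × t₁ and turns it into t₁ × t₂, and the remaining ε is absorbed into x. -/
theorem convolution_comm_of_isCommutativeQSystem (h : ConjugacyRelations ι ιbar w v)
    (𝒞 : BraidedFullSubcategory A) (hθ : dualCanonicalEnd ι ιbar ∈ 𝒞.obj)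
    (hQ : IsCommutativeQSystem 𝒞 hθ v)
    (t₁ t₂ : Hom (dualCanonicalEnd ι ιbar) (dualCanonicalEnd ι ιbar)) :
    convolution w v t₁ t₂ = convolution w v t₂ t₁ := by
  rw [convolution_eq_qComult_conj h, convolution_eq_qComult_conj h]
  set Θ : 𝒞.obj := ⟨dualCanonicalEnd ι ιbar, hθ⟩
  apply Subtype.ext
  have hnat : (𝒞.ε Θ Θ : A) * (tens t₂ t₁ : Hom _ _).1 = (tens t₁ t₂ : Hom _ _).1 * 𝒞.ε Θ Θ :=
    congrArg Subtype.val (𝒞.naturality Θ Θ Θ Θ t₂ t₁)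
  have hx : (𝒞.ε Θ Θ : A) * (qComult v : Hom _ _).1 = (qComult v : Hom _ _).1 :=
    congrArg Subtype.val hQ
  have hu : star (𝒞.ε Θ Θ : A) * (𝒞.ε Θ Θ : A) = 1 := congrArg Subtype.val (𝒞.adj_comp Θ Θ)
  change star (qComult v : Hom _ _).1 * ((tens t₂ t₁ : Hom _ _).1 * (qComult v : Hom _ _).1) =
    star (qComult v : Hom _ _).1 * ((tens t₁ t₂ : Hom _ _).1 * (qComult v : Hom _ _).1)
  generalize (𝒞.ε Θ Θ : A) = e at *
  generalize (qComult v : Hom _ _).1 = x at *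
  generalize (tens t₂ t₁ : Hom _ _).1 = a at *
  generalize (tens t₁ t₂ : Hom _ _).1 = b at *
  calc star x * (a * x) = star x * (star e * e * a * x) := by rw [hu, one_mul]
    _ = star (e * x) * (e * a * x) := by simp only [star_mul, mul_assoc]
    _ = star x * (b * (e * x)) := by rw [hnat, mul_assoc b, hx]
    _ = star x * (b * x) := by rw [hx]

/-- The solution `R = ι(w) v` of the conjugacy relations for the self-conjugate `γ`. -/
def canonicalSolution (w : Hom (StarAlgHom.id ℂ A) (dualCanonicalEnd ι ιbar))
    (v : Hom (StarAlgHom.id ℂ B) (canonicalEnd ι ιbar)) : B := ι (w : A) * v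

theorem canonicalSolution_mul (b : B) :
    canonicalSolution w v * b =
      canonicalEnd ι ιbar (canonicalEnd ι ιbar b) * canonicalSolution w v := by
  change ι (w : A) * v * b = ι (ιbar (ι (ιbar b))) * (ι (w : A) * v)
  rw [mul_assoc, coe_mul_eq v, ← mul_assoc, ← map_mul, coe_mul_eq w, map_mul, mul_assoc]

/-- Moving w* past θ(w) splits the product into v*ι(w) and ι(w*ῑ(v)), both equal to 1. -/
theorem star_canonicalSolution_mul_map (h : ConjugacyRelations ι ιbar w v) :
    star (canonicalSolution w v) * canonicalEnd ι ιbar (canonicalSolution w v) = 1 := by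
  change star (ι (w : A) * (v : B)) * ι (ιbar (ι (w : A) * (v : B))) = 1
  calc _ = star (v : B) * ι (star (w : A) * ιbar (ι (w : A))) * ι (ιbar (v : B)) := by
        simp only [star_mul, map_mul, map_star, mul_assoc]
    _ = star (v : B) * ι (w : A) * ι (star (w : A) * ιbar (v : B)) := by
        rw [star_coe_mul_eq w]; simp only [map_mul, mul_assoc]
    _ = 1 := by rw [h.star_mul_map, h.star_mul_map', map_one, one_mul]

theorem star_canonicalSolution_mul_self {d : ℝ} (h : IsNormalized w v d) :
    star (canonicalSolution w v) * canonicalSolution w v = ((d : ℂ) ^ 2) • (1 : B) := by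
  have hw : star (w : A) * (w : A) = (d : ℂ) • 1 := congrArg Subtype.val h.1
  have hv : star (v : B) * (v : B) = (d : ℂ) • 1 := congrArg Subtype.val h.2
  calc _ = star (v : B) * ι (star (w : A) * w) * v := by
        simp only [canonicalSolution, star_mul, map_mul, map_star, mul_assoc]
    _ = _ := by
        rw [hw, map_smul, map_one, mul_smul_comm, smul_mul_assoc, mul_one, hv, smul_smul, pow_two]

end Fourier

/-! ### Minimal projections in a commutative algebra with bounded orthogonal families. -/

section MinimalProjections

open Set

variable {E : Type*} [CStarAlgebra E] [PartialOrder E] [StarOrderedRing E]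

/-- A finite family of nonzero, pairwise orthogonal positive elements of `A`. -/
def IsOrthogonalPositiveFamily (A : StarSubalgebra ℂ E) {n : ℕ} (a : Fin n → E) : Prop :=
  (∀ i, a i ∈ A) ∧ (∀ i, 0 ≤ a i) ∧ (∀ i, a i ≠ 0) ∧ ∀ i j, i ≠ j → a i * a j = 0

theorem mul_eq_zero_swap {x y : E} (hx : 0 ≤ x) (hy : 0 ≤ y) (h : x * y = 0) : y * x = 0 := by
  have := congrArg star h
  rwa [star_mul, (IsSelfAdjoint.of_nonneg hx).star_eq, (IsSelfAdjoint.of_nonneg hy).star_eq,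
    star_zero] at this

theorem IsOrthogonalPositiveFamily.cons {A : StarSubalgebra ℂ E} {n : ℕ} {a : Fin n → E}
    (ha : IsOrthogonalPositiveFamily A a) {b : E} (hb : b ∈ A) (hb₀ : 0 ≤ b) (hb₁ : b ≠ 0)
    (hab : ∀ i, b * a i = 0) :
    IsOrthogonalPositiveFamily A (Fin.cons b a : Fin (n + 1) → E) := by
  obtain ⟨h₁, h₂, h₃, h₄⟩ := ha
  refine ⟨Fin.cases hb h₁, Fin.cases hb₀ h₂, Fin.cases hb₁ h₃, fun i j => ?_⟩
  induction i using Fin.cases with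
  | zero =>
    induction j using Fin.cases with
    | zero => simp
    | succ j => intro _; exact hab j
  | succ i =>
    induction j using Fin.cases with
    | zero => intro _; exact mul_eq_zero_swap hb₀ (h₂ i) (hab i)
    | succ j => intro hij; exact h₄ i j (fun h => hij (h ▸ rfl))

theorem IsOrthogonalPositiveFamily.update {A : StarSubalgebra ℂ E} {n : ℕ} {a : Fin n → E}
    (ha : IsOrthogonalPositiveFamily A a) (i : Fin n) {b : E} (hb : b ∈ A) (hb₀ : 0 ≤ b)
    (hb₁ : b ≠ 0) (hab : ∀ j, j ≠ i → b * a j = 0) :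
    IsOrthogonalPositiveFamily A (Function.update a i b) := by
  obtain ⟨h₁, h₂, h₃, h₄⟩ := ha
  refine ⟨fun j => ?_, fun j => ?_, fun j => ?_, fun j k hjk => ?_⟩
  · rw [Function.update_apply]; split_ifs; exacts [hb, h₁ j]
  · rw [Function.update_apply]; split_ifs; exacts [hb₀, h₂ j]
  · rw [Function.update_apply]; split_ifs; exacts [hb₁, h₃ j]
  · rw [Function.update_apply, Function.update_apply]
    split_ifs with hj hk hk
    · exact absurd (hj.trans hk.symm) hjk
    · exact hab k hk
    · exact mul_eq_zero_swap hb₀ (h₂ j) (hab j hj)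
    · exact h₄ j k hjk

variable {A : StarSubalgebra ℂ E}

theorem negPart_mem {E : Type*} [CStarAlgebra E] {A : StarSubalgebra ℂ E}
    (hpos : ∀ b ∈ A, IsSelfAdjoint b → b⁺ ∈ A) {b : E} (hb : b ∈ A)
    (hb' : IsSelfAdjoint b) : b⁻ ∈ A := by
  rw [← CFC.posPart_neg]
  exact hpos _ (neg_mem hb) hb'.neg

/-- (bc)*(bc) = c(b(bc)) = 0. It serves to pass from b²c = 0 to bc = 0 for the positive and negative
parts. -/
theorem eq_zero_of_mul_self_mul {E : Type*} [CStarAlgebra E] {b c : E}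
    (hb : IsSelfAdjoint b) (hc : IsSelfAdjoint c)
    (h : b * (b * c) = 0) : b * c = 0 := by
  rw [← CStarRing.star_mul_self_eq_zero_iff, star_mul, hb.star_eq, hc.star_eq, mul_assoc, h,
    mul_zero]

/-- In a maximal orthogonal family, a self-adjoint element annihilating all members but one has a
definite sign. -/
theorem IsOrthogonalPositiveFamily.nonneg_or_nonpos (hpos : ∀ b ∈ A, IsSelfAdjoint b → b⁺ ∈ A)
    {n : ℕ} {a : Fin n → E} (ha : IsOrthogonalPositiveFamily A a)
    (hmax : ¬ ∃ a' : Fin (n + 1) → E, IsOrthogonalPositiveFamily A a') (i : Fin n) {b : E}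
    (hb : b ∈ A) (hb' : IsSelfAdjoint b) (hab : ∀ j, j ≠ i → b * a j = 0) : 0 ≤ b ∨ b ≤ 0 := by
  by_contra! h
  have hp₀ : b⁺ ≠ 0 := fun h' => h.2 ((CFC.posPart_eq_zero_iff b).1 h')
  have hn₀ : b⁻ ≠ 0 := fun h' => h.1 ((CFC.negPart_eq_zero_iff b).1 h')
  have hdec := CFC.posPart_sub_negPart b hb'
  have hpsa : IsSelfAdjoint b⁺ := .of_nonneg (CFC.posPart_nonneg b)
  have hnsa : IsSelfAdjoint b⁻ := .of_nonneg (CFC.negPart_nonneg b)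
  have hp : ∀ j, j ≠ i → b⁺ * a j = 0 := fun j hj => by
    refine eq_zero_of_mul_self_mul hpsa (.of_nonneg (ha.2.1 j)) ?_
    have : b⁺ * b = b⁺ * b⁺ := by
      calc b⁺ * b = b⁺ * (b⁺ - b⁻) := by rw [hdec]
        _ = _ := by rw [mul_sub, CFC.posPart_mul_negPart, sub_zero]
    rw [← mul_assoc, ← this, mul_assoc, hab j hj, mul_zero]
  have hn : ∀ j, j ≠ i → b⁻ * a j = 0 := fun j hj => by
    refine eq_zero_of_mul_self_mul hnsa (.of_nonneg (ha.2.1 j)) ?_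
    have : b⁻ * b = -(b⁻ * b⁻) := by
      calc b⁻ * b = b⁻ * (b⁺ - b⁻) := by rw [hdec]
        _ = _ := by rw [mul_sub, CFC.negPart_mul_posPart, zero_sub]
    rw [← mul_assoc, ← neg_eq_zero, ← neg_mul, ← this, mul_assoc, hab j hj, mul_zero]
  -- If both parts were nonzero, replacing a i by b⁺ and adjoining b⁻ would lengthen the family.
  refine hmax ⟨_, (ha.update i (hpos b hb hb') (CFC.posPart_nonneg b) hp₀ hp).cons
    (negPart_mem hpos hb hb') (CFC.negPart_nonneg b) hn₀ fun j => ?_⟩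
  rw [Function.update_apply]
  split_ifs with hj
  · exact CFC.negPart_mul_posPart b
  · exact hn j hj

/-- Otherwise x ≤ -t a for every t ≥ 0, so t‖a‖ ≤ ‖x‖ for all t, which is impossible as a ≠ 0. -/
theorem exists_nonneg_sub_smul {a x : E} (ha : 0 ≤ a) (ha₀ : a ≠ 0)
    (h : ∀ c : ℝ, 0 ≤ x - c • a ∨ x - c • a ≤ 0) : ∃ c : ℝ, 0 ≤ x - c • a := by
  by_contra! hneg
  have key : ∀ t : ℝ, 0 ≤ t → t * ‖a‖ ≤ ‖x‖ := fun t ht => by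
    have h₁ := (h (-t)).resolve_left (hneg (-t))
    have h₂ : t • a ≤ -x := by
      rw [neg_smul, sub_neg_eq_add, add_comm] at h₁
      exact le_neg_iff_add_nonpos_right.2 h₁
    have := CStarAlgebra.norm_le_norm_of_nonneg_of_le (smul_nonneg ht ha) h₂
    rwa [norm_smul, norm_neg, Real.norm_of_nonneg ht] at this
  have hpos : 0 < ‖a‖ := norm_pos_iff.2 ha₀
  have := key ((‖x‖ + 1) / ‖a‖) (by positivity)
  rw [div_mul_cancel₀ _ hpos.ne'] at this
  linarith

/-- The c with x - ca ≥ 0 and those with x - ca ≤ 0 form two nonempty closed sets covering the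
connected line, so they meet. -/
theorem exists_eq_smul_of_comparable {a x : E} (ha : 0 ≤ a) (ha₀ : a ≠ 0)
    (h : ∀ c : ℝ, 0 ≤ x - c • a ∨ x - c • a ≤ 0) : ∃ c : ℝ, x = c • a := by
  have hcont : Continuous fun c : ℝ => x - c • a := by fun_prop
  obtain ⟨c₁, h₁⟩ := exists_nonneg_sub_smul ha ha₀ h
  obtain ⟨c₂, h₂⟩ := exists_nonneg_sub_smul (x := -x) ha ha₀ fun c => by
    refine (h (-c)).symm.imp (fun h => ?_) (fun h => ?_)
    · rw [← neg_nonpos]; simpa [sub_eq_add_neg, add_comm] using h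
    · rw [← neg_nonneg]; simpa [sub_eq_add_neg, add_comm] using h
  have h₂' : x - (-c₂) • a ≤ 0 := by
    rw [← neg_nonneg]; simpa [sub_eq_add_neg, add_comm] using h₂
  obtain ⟨c, -, hc₁, hc₂⟩ := isPreconnected_closed_iff.1 (isPreconnected_univ (α := ℝ))
    {c | 0 ≤ x - c • a} {c | x - c • a ≤ 0} (isClosed_le continuous_const hcont)
    (isClosed_le hcont continuous_const) (fun c _ => h c) ⟨c₁, trivial, h₁⟩ ⟨-c₂, trivial, h₂'⟩
  exact ⟨c, sub_eq_zero.1 (le_antisymm hc₂ hc₁)⟩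

/-- Each x a i - c a i is self-adjoint and annihilates the other members, so by maximality it has a
definite sign. -/
theorem IsOrthogonalPositiveFamily.exists_mul_eq_real_smul
    (hcomm : ∀ x ∈ A, ∀ y ∈ A, x * y = y * x)
    (hpos : ∀ b ∈ A, IsSelfAdjoint b → b⁺ ∈ A)
    {n : ℕ} {a : Fin n → E} (ha : IsOrthogonalPositiveFamily A a)
    (hmax : ¬ ∃ a' : Fin (n + 1) → E, IsOrthogonalPositiveFamily A a') (i : Fin n) {x : E}
    (hx : x ∈ A) (hx' : IsSelfAdjoint x) : ∃ c : ℝ, x * a i = c • a i := by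
  refine exists_eq_smul_of_comparable (ha.2.1 i) (ha.2.2.1 i) fun c => ?_
  have hai : IsSelfAdjoint (a i) := .of_nonneg (ha.2.1 i)
  refine ha.nonneg_or_nonpos hpos hmax i ?_ ?_ fun j hj => ?_
  · refine sub_mem (mul_mem hx (ha.1 i)) ?_
    rw [← Complex.coe_smul]
    exact A.smul_mem (ha.1 i) _
  · refine .sub ?_ ((IsSelfAdjoint.all c).smul hai)
    rw [isSelfAdjoint_iff, star_mul, hx'.star_eq, hai.star_eq]
    exact hcomm _ (ha.1 i) _ hx
  · rw [sub_mul, mul_assoc, smul_mul_assoc, ha.2.2.2 i j hj.symm, mul_zero, smul_zero, sub_zero]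

theorem IsOrthogonalPositiveFamily.exists_mul_eq_smul
    (hcomm : ∀ x ∈ A, ∀ y ∈ A, x * y = y * x)
    (hpos : ∀ b ∈ A, IsSelfAdjoint b → b⁺ ∈ A)
    {n : ℕ} {a : Fin n → E} (ha : IsOrthogonalPositiveFamily A a)
    (hmax : ¬ ∃ a' : Fin (n + 1) → E, IsOrthogonalPositiveFamily A a') (i : Fin n) {x : E}
    (hx : x ∈ A) : ∃ c : ℂ, x * a i = c • a i := by
  obtain ⟨r, hr⟩ := ha.exists_mul_eq_real_smul hcomm hpos hmax i (x := x + star x)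
    (add_mem hx (star_mem hx)) (IsSelfAdjoint.add_star_self x)
  obtain ⟨s, hs⟩ := ha.exists_mul_eq_real_smul hcomm hpos hmax i (x := Complex.I • (x - star x))
    (A.smul_mem (sub_mem hx (star_mem hx)) _) (by
      rw [isSelfAdjoint_iff, star_smul, star_sub, star_star, ← neg_sub x (star x), Complex.star_def,
        Complex.conj_I, neg_smul, smul_neg, neg_neg])
  refine ⟨(1 / 2 : ℂ) * r - (Complex.I / 2) * s, ?_⟩
  have hdec : x = (1 / 2 : ℂ) • (x + star x) - (Complex.I / 2) • (Complex.I • (x - star x)) := by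
    rw [smul_smul, show Complex.I / 2 * Complex.I = -(1 / 2 : ℂ) by
      rw [div_mul_eq_mul_div, Complex.I_mul_I]; ring]
    module
  conv_lhs => rw [hdec, sub_mul, smul_mul_assoc, smul_mul_assoc, hr, hs]
  rw [← Complex.coe_smul, ← Complex.coe_smul, smul_smul, smul_smul, sub_smul]

/-- A commutative `*`-algebra which is closed under positive parts and admits only orthogonal
families of bounded length is spanned by finitely many minimal projections with sum `1`. -/
theorem exists_minimal_projections (hcomm : ∀ x ∈ A, ∀ y ∈ A, x * y = y * x)
    (hpos : ∀ b ∈ A, IsSelfAdjoint b → b⁺ ∈ A) (N : ℕ)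
    (hN : ∀ n (a : Fin n → E), IsOrthogonalPositiveFamily A a → n ≤ N) :
    ∃ (n : ℕ) (p : Fin n → E), (∀ i, p i ∈ A) ∧ (∀ i, IsStarProjection (p i)) ∧
      (∀ i, p i ≠ 0) ∧ (∀ i j, i ≠ j → p i * p j = 0) ∧ ∑ i, p i = 1 ∧
      ∀ x ∈ A, ∀ i, ∃ c : ℂ, x * p i = c • p i := by
  obtain ⟨n, ⟨a, ha⟩, hmax⟩ : ∃ n, (∃ a : Fin n → E, IsOrthogonalPositiveFamily A a) ∧
      ¬ ∃ a : Fin (n + 1) → E, IsOrthogonalPositiveFamily A a := by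
    by_contra! H
    have : ∀ n, ∃ a : Fin n → E, IsOrthogonalPositiveFamily A a := fun n => by
      induction n with
      | zero => exact ⟨Fin.elim0, fun i => i.elim0, fun i => i.elim0, fun i => i.elim0, fun i => i.elim0⟩
      | succ n ih => exact H n ih
    obtain ⟨a, ha⟩ := this (N + 1)
    exact absurd (hN _ a ha) (by omega)
  have hsa : ∀ i, IsSelfAdjoint (a i) := fun i => .of_nonneg (ha.2.1 i)
  have hsq : ∀ i, ∃ c : ℝ, a i * a i = c • a i := fun i =>
    ha.exists_mul_eq_real_smul hcomm hpos hmax i (ha.1 i) (hsa i)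
  choose c hc using hsq
  have hc₀ : ∀ i, c i ≠ 0 := fun i h => by
    have := hc i
    rw [h, zero_smul] at this
    have h' : star (a i) * a i = 0 := by rw [(hsa i).star_eq, this]
    exact ha.2.2.1 i ((CStarRing.star_mul_self_eq_zero_iff _).1 h')
  -- Since a i squares to c i times itself, dividing by c i makes it idempotent.
  set p : Fin n → E := fun i => (c i)⁻¹ • a i with hp
  have hpA : ∀ i, p i ∈ A := fun i => by
    change (c i)⁻¹ • a i ∈ A
    rw [← Complex.coe_smul]; exact A.smul_mem (ha.1 i) _
  have hpp : ∀ i, IsStarProjection (p i) := fun i => by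
    refine ⟨?_, (IsSelfAdjoint.all (c i)⁻¹).smul (hsa i)⟩
    change (c i)⁻¹ • a i * (c i)⁻¹ • a i = (c i)⁻¹ • a i
    rw [smul_mul_smul_comm, hc, smul_smul, mul_assoc, inv_mul_cancel₀ (hc₀ i), mul_one]
  have horth : ∀ i j, i ≠ j → p i * p j = 0 := fun i j hij => by
    change (c i)⁻¹ • a i * (c j)⁻¹ • a j = 0
    rw [smul_mul_smul_comm, ha.2.2.2 i j hij, smul_zero]
  refine ⟨n, p, hpA, hpp, fun i => smul_ne_zero (inv_ne_zero (hc₀ i)) (ha.2.2.1 i), horth, ?_,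
    fun x hx i => ?_⟩
  -- If the sum were not 1, its complement would be a further nonzero projection orthogonal to the
  -- family.
  · by_contra hne
    have hq : ∀ i, (1 - ∑ j, p j) * p i = 0 := fun i => by
      rw [sub_mul, one_mul, Finset.sum_mul, Finset.sum_eq_single i
        (fun j _ hj => horth j i hj) (by simp), (hpp i).isIdempotentElem.eq, sub_self]
    have hqsa : IsSelfAdjoint (1 - ∑ j, p j) :=
      (IsSelfAdjoint.one E).sub (isSelfAdjoint_sum _ fun j _ => (hpp j).isSelfAdjoint)
    have hqq : (1 - ∑ j, p j) * (1 - ∑ j, p j) = 1 - ∑ j, p j := by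
      rw [mul_sub, mul_one, Finset.mul_sum, Finset.sum_eq_zero (fun i _ => hq i), sub_zero]
    refine hmax ⟨_, ha.cons (b := 1 - ∑ j, p j) (sub_mem (one_mem A) (sum_mem fun i _ => hpA i))
      ?_ (sub_ne_zero.2 (Ne.symm hne)) fun i => ?_⟩
    · rw [← hqq]
      nth_rw 1 [← hqsa.star_eq]
      exact star_mul_self_nonneg _
    · have := hq i
      rw [hp] at this
      simp only [mul_smul_comm] at this
      exact (smul_eq_zero.1 this).resolve_left (inv_ne_zero (hc₀ i))
  · obtain ⟨z, hz⟩ := ha.exists_mul_eq_smul hcomm hpos hmax i hx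
    refine ⟨z, ?_⟩
    change x * (c i)⁻¹ • a i = z • (c i)⁻¹ • a i
    rw [mul_smul_comm, hz, smul_comm]

end MinimalProjections

/-! ### Partial isometries, polar decomposition and comparison of projections in a factor. -/

section Comparison

variable {H : Type*} [NormedAddCommGroup H] [InnerProductSpace ℂ H] [CompleteSpace H]

open ContinuousLinearMap InnerProductSpace

theorem star_apply_inner (x : H →L[ℂ] H) (ξ η : H) : inner ℂ ((star x) ξ) η = inner ℂ ξ (x η) := by
  rw [star_eq_adjoint, adjoint_inner_left]

theorem mem_iff_forall_commutant {S : VonNeumannAlgebra H} {x : H →L[ℂ] H} :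
    x ∈ S ↔ ∀ y ∈ S.commutant, y * x = x * y := by
  rw [← VonNeumannAlgebra.commutant_commutant S, VonNeumannAlgebra.mem_commutant_iff]
  simp

theorem mul_comm_of_mem_commutant {S : VonNeumannAlgebra H} {x y : H →L[ℂ] H} (hx : x ∈ S)
    (hy : y ∈ S.commutant) : y * x = x * y := mem_iff_forall_commutant.1 hx y hy

/-- The projection onto the closed span of a set invariant under the commutant of `S` is in `S`. -/
theorem starProjection_closure_span_mem (S : VonNeumannAlgebra H) (s : Set H)
    (hs : ∀ y ∈ S.commutant, ∀ z ∈ s, y z ∈ s) :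
    (Submodule.span ℂ s).topologicalClosure.starProjection ∈ S := by
  rw [VonNeumannAlgebra.IsStarProjection.mem_iff isStarProjection_starProjection]
  intro y hy
  rw [Submodule.range_starProjection, Module.End.mem_invtSubmodule]
  have h₁ : Submodule.span ℂ s ≤ (Submodule.span ℂ s).comap (y : H →ₗ[ℂ] H) :=
    Submodule.span_le.2 fun z hz => Submodule.subset_span (hs y hy z hz)
  intro z hz
  exact (map_mem_closure y.continuous hz fun z hz => h₁ hz)

theorem eqOn_closure_span {H : Type*} [NormedAddCommGroup H] [InnerProductSpace ℂ H]
    {s : Set H} {x y : H →L[ℂ] H} (h : ∀ z ∈ s, x z = y z)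
    {z : H} (hz : z ∈ (Submodule.span ℂ s).topologicalClosure) : x z = y z := by
  have h₁ : Submodule.span ℂ s ≤ LinearMap.eqLocus (x : H →ₗ[ℂ] H) (y : H →ₗ[ℂ] H) :=
    Submodule.span_le.2 h
  exact Submodule.topologicalClosure_minimal _ h₁ (isClosed_eq x.continuous y.continuous) hz

/-- If `a, b : V → H` satisfy `‖a x‖ = ‖b x‖`, then `a x ↦ b x` extends to a partial isometry `u`
with initial space the closure of the range of `a`; it is in `S` whenever `a` and `b` intertwine
the commutant of `S`. -/
theorem exists_partialIsometry (S : VonNeumannAlgebra H) {V : Type*} [AddCommGroup V] [Module ℂ V]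
    (a b : V →ₗ[ℂ] H) (hab : ∀ x, ‖b x‖ = ‖a x‖)
    (hinv : ∀ y ∈ S.commutant, ∃ g : V → V, (∀ x, a (g x) = y (a x)) ∧ ∀ x, b (g x) = y (b x)) :
    ∃ u ∈ S, (∀ x, u (a x) = b x) ∧
      star u * u = (LinearMap.range a).topologicalClosure.starProjection ∧
      ∀ c : H →L[ℂ] H, (∀ x, c (b x) = 0) → c * u = 0 := by
  set K := (LinearMap.range a).topologicalClosure with hK
  have haK : ∀ x, a x ∈ K := fun x => Submodule.le_topologicalClosure _ ⟨x, rfl⟩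
  -- The operator u is prescribed by a x + z ↦ b x on the dense subspace range(a) + Kᗮ and extended
  -- by continuity.
  let e : (V × Kᗮ) →ₗ[ℂ] H := a.coprod Kᗮ.subtype
  let f : (V × Kᗮ) →ₗ[ℂ] H := b.comp (LinearMap.fst ℂ V Kᗮ)
  have he : ∀ x (z : Kᗮ), e (x, z) = a x + z := fun x z => by simp [e]
  have hf : ∀ x (z : Kᗮ), f (x, z) = b x := fun x z => by simp [f]
  have hproj : ∀ x (z : Kᗮ), K.starProjection (a x + z) = a x := fun x z => by
    rw [map_add, Submodule.starProjection_eq_self_iff.2 (haK x),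
      (Submodule.starProjection_apply_eq_zero_iff K).2 z.2, add_zero]
  have hdense : DenseRange e := by
    have : (LinearMap.range e).topologicalClosure = ⊤ := by
      rw [eq_top_iff, ← Submodule.sup_orthogonal_of_hasOrthogonalProjection (K := K)]
      refine sup_le ?_ ?_
      · refine Submodule.topologicalClosure_mono ?_
        rintro _ ⟨x, rfl⟩
        exact ⟨(x, 0), by simp [he]⟩
      · intro z hz
        exact Submodule.le_topologicalClosure _ ⟨(0, ⟨z, hz⟩), by simp [he]⟩
    exact Submodule.dense_iff_topologicalClosure_eq_top.2 this
  have hbound : ∀ q, ‖f q‖ ≤ 1 * ‖e q‖ := by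
    rintro ⟨x, z⟩
    rw [hf, he, hab, one_mul]
    nth_rw 1 [← hproj x z]
    exact Submodule.norm_starProjection_apply_le K _
  set u : H →L[ℂ] H := f.extendOfNorm e with hu
  have hue : ∀ x (z : Kᗮ), u (a x + z) = b x := fun x z => by
    rw [← he, ← hf x z]; exact LinearMap.extendOfNorm_eq hdense ⟨1, hbound⟩ (x, z)
  have hext : ∀ {p q : H →L[ℂ] H}, (∀ x (z : Kᗮ), p (a x + z) = q (a x + z)) → p = q := by
    intro p q h
    refine ContinuousLinearMap.ext fun ξ => ?_
    refine congrFun (hdense.equalizer p.continuous q.continuous ?_) ξ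
    funext ⟨x, z⟩
    simpa only [Function.comp, he] using h x z
  have hnorm : ∀ ξ, ‖u ξ‖ = ‖K.starProjection ξ‖ := by
    intro ξ
    refine congrFun (hdense.equalizer (g := fun ξ => ‖u ξ‖) (h := fun ξ => ‖K.starProjection ξ‖)
      (by fun_prop) (by fun_prop) ?_) ξ
    funext ⟨x, z⟩
    simp only [Function.comp, he, hue, hproj, hab]
  refine ⟨u, ?_, fun x => by simpa using hue x 0, ?_, fun c hc => ?_⟩
  · rw [mem_iff_forall_commutant]
    intro y hy
    refine hext fun x z => ?_
    obtain ⟨g, hg₁, hg₂⟩ := hinv y hy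
    -- The adjoint y* also lies in the commutant and preserves the range of a, so y preserves Kᗮ.
    have hz : y z ∈ Kᗮ := by
      have hys : star y ∈ S.commutant := star_mem hy
      obtain ⟨g', hg', -⟩ := hinv _ hys
      refine (Submodule.orthogonal_closure (LinearMap.range a)).ge ?_
      rw [Submodule.mem_orthogonal]
      rintro _ ⟨x', rfl⟩
      rw [← star_apply_inner, ← hg']
      exact Submodule.inner_right_of_mem_orthogonal (haK _) z.2
    change y (u (a x + z)) = u (y (a x + z))
    rw [hue, map_add, ← hg₁, ← hg₂]
    exact (hue (g x) ⟨y z, hz⟩).symm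
  · refine ContinuousLinearMap.coe_injective ?_
    rw [← ext_inner_map]
    intro ξ
    change inner ℂ ((star u) (u ξ)) ξ = inner ℂ (K.starProjection ξ) ξ
    rw [star_apply_inner, inner_self_eq_norm_sq_to_K, hnorm, ← inner_self_eq_norm_sq_to_K (𝕜 := ℂ),
      Submodule.inner_starProjection_left_eq_right,
      Submodule.starProjection_eq_self_iff.2 (Submodule.starProjection_apply_mem K ξ),
      ← Submodule.inner_starProjection_left_eq_right]
  · exact hext fun x z => by
      change c (u (a x + z)) = 0
      rw [hue, hc]

theorem mul_eq_zero_of_star_mul_self_mul {u c : H →L[ℂ] H} (h : star u * u * c = 0) : u * c = 0 := by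
  rw [← CStarRing.star_mul_self_eq_zero_iff, star_mul, mul_assoc, ← mul_assoc (star u), h, mul_zero]

theorem mul_star_mul_self_of_isStarProjection {u : H →L[ℂ] H}
    (h : IsStarProjection (star u * u)) : u * (star u * u) = u := by
  rw [← sub_eq_zero]
  nth_rw 4 [← mul_one u]
  rw [← mul_sub]
  apply mul_eq_zero_of_star_mul_self_mul
  rw [mul_sub, h.isIdempotentElem.eq, mul_one, sub_self]

/-- The phase of the polar decomposition of `x`, with its support properties. -/
theorem exists_polar_phase {S : VonNeumannAlgebra H} {x : H →L[ℂ] H} (hx : x ∈ S) (hx₀ : x ≠ 0) :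
    ∃ u ∈ S, u ≠ 0 ∧ IsStarProjection (star u * u) ∧ (∀ c : H →L[ℂ] H, c * x = 0 → c * u = 0) ∧
      ∀ c : H →L[ℂ] H, x * c = 0 → u * c = 0 := by
  set m := CFC.abs x with hm
  have hmm : m * m = star x * x := CFC.abs_mul_abs x
  have hmsa : star m = m := (IsSelfAdjoint.of_nonneg (CFC.abs_nonneg x)).star_eq
  have hnorm : ∀ ξ, ‖x ξ‖ = ‖m ξ‖ := fun ξ => by
    have : inner ℂ (x ξ) (x ξ) = (inner ℂ (m ξ) (m ξ) : ℂ) := by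
      rw [← star_apply_inner x, ← star_apply_inner m, hmsa]
      exact congrArg (fun z : H →L[ℂ] H => inner ℂ (z ξ) ξ) hmm.symm
    rw [inner_self_eq_norm_sq_to_K, inner_self_eq_norm_sq_to_K] at this
    have h2 : ‖x ξ‖ ^ 2 = ‖m ξ‖ ^ 2 := by exact_mod_cast this
    exact (sq_eq_sq₀ (norm_nonneg _) (norm_nonneg _)).1 h2
  -- The phase is the map |x|ξ ↦ xξ; whatever commutes with x and x* commutes with |x|.
  obtain ⟨u, huS, hu, huu, huc⟩ := exists_partialIsometry S (m : H →ₗ[ℂ] H) (x : H →ₗ[ℂ] H) hnorm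
    fun y hy => by
      have h₁ : y * x = x * y := mul_comm_of_mem_commutant hx hy
      have h₂ : star y * x = x * star y := mul_comm_of_mem_commutant hx (star_mem hy)
      have h₃ : y * m = m * y := (Commute.cfcAbs_right h₁.symm h₂.symm).eq
      exact ⟨y, fun ξ => (congrArg (fun z : H →L[ℂ] H => z ξ) h₃).symm,
        fun ξ => (congrArg (fun z : H →L[ℂ] H => z ξ) h₁).symm⟩
  refine ⟨u, huS, ?_, huu ▸ isStarProjection_starProjection, fun c hc => huc c fun ξ => ?_,
    fun c hc => ?_⟩
  · rintro rfl
    exact hx₀ (ContinuousLinearMap.ext fun ξ => (hu ξ).symm)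
  · exact congrArg (fun z : H →L[ℂ] H => z ξ) hc
  · apply mul_eq_zero_of_star_mul_self_mul
    rw [huu]
    have hmc : m * c = 0 := ContinuousLinearMap.ext fun ξ => by
      change m (c ξ) = 0
      rw [← norm_eq_zero, ← hnorm, norm_eq_zero]
      exact congrArg (fun z : H →L[ℂ] H => z ξ) hc
    refine ContinuousLinearMap.ext fun ξ => ?_
    change (LinearMap.range (m : H →ₗ[ℂ] H)).topologicalClosure.starProjection (c ξ) = 0
    rw [Submodule.starProjection_apply_eq_zero_iff, Submodule.orthogonal_closure,
      Submodule.mem_orthogonal]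
    rintro _ ⟨η, rfl⟩
    change inner ℂ (m η) (c ξ) = 0
    rw [← hmsa, star_apply_inner]
    rw [show m (c ξ) = 0 from congrArg (fun z : H →L[ℂ] H => z ξ) hmc, inner_zero_right]

/-- The projection onto the closed span of MqH lies in M and in M', so it is a scalar, nonzero
because the span contains qH. If eMq = 0, then e vanishes on this span, hence everywhere. -/
theorem exists_mul_mul_ne_zero {M : VonNeumannAlgebra H} (hM : IsFactor M) {e q : H →L[ℂ] H}
    (hq : q ∈ M) (he₀ : e ≠ 0) (hq₀ : q ≠ 0) : ∃ y ∈ M, e * y * q ≠ 0 := by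
  by_contra! h
  set s : Set H := {z | ∃ y ∈ M, ∃ ξ, z = y (q ξ)} with hs
  have h₁ := starProjection_closure_span_mem M s (by
    rintro y hy _ ⟨x, hx, ξ, rfl⟩
    refine ⟨x, hx, y ξ, ?_⟩
    have := mul_comm_of_mem_commutant (mul_mem hx hq) hy
    exact congrArg (fun z : H →L[ℂ] H => z ξ) this)
  have h₂ := starProjection_closure_span_mem M.commutant s (by
    rw [VonNeumannAlgebra.commutant_commutant]
    rintro y hy _ ⟨x, hx, ξ, rfl⟩
    exact ⟨y * x, mul_mem hy hx, ξ, rfl⟩)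
  obtain ⟨c, hc⟩ := hM.2 _ h₁ h₂
  have hker : ∀ z ∈ (Submodule.span ℂ s).topologicalClosure, e z = (0 : H →L[ℂ] H) z := by
    intro z hz
    refine eqOn_closure_span ?_ hz
    rintro _ ⟨y, hy, ξ, rfl⟩
    exact congrArg (fun z : H →L[ℂ] H => z ξ) (h y hy)
  obtain ⟨ξ, hξ⟩ : ∃ ξ, q ξ ≠ 0 := by
    by_contra! h'
    exact hq₀ (ContinuousLinearMap.ext h')
  have hc₀ : c ≠ 0 := by
    rintro rfl
    have hmem : q ξ ∈ (Submodule.span ℂ s).topologicalClosure :=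
      Submodule.le_topologicalClosure _ (Submodule.subset_span ⟨1, one_mem M, ξ, rfl⟩)
    rw [← Submodule.starProjection_eq_self_iff, hc, zero_smul] at hmem
    exact hξ hmem.symm
  refine he₀ (ContinuousLinearMap.ext fun η => ?_)
  have := hker _ (Submodule.starProjection_apply_mem (Submodule.span ℂ s).topologicalClosure η)
  rw [hc] at this
  change e (c • η) = 0 at this
  rw [map_smul] at this
  exact (smul_eq_zero.1 this).resolve_left hc₀

/-- Nonzero projections in a factor have nonzero equivalent subprojections. -/
theorem exists_partialIsometry_between {M : VonNeumannAlgebra H} (hM : IsFactor M)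
    {e q : H →L[ℂ] H} (he : e ∈ M) (hq : q ∈ M) (he' : IsStarProjection e)
    (hq' : IsStarProjection q) (he₀ : e ≠ 0) (hq₀ : q ≠ 0) :
    ∃ k ∈ M, k ≠ 0 ∧ IsStarProjection (star k * k) ∧ e * k = k ∧ k * q = k := by
  obtain ⟨y, hy, hne⟩ := exists_mul_mul_ne_zero hM hq he₀ hq₀
  -- The phase of eyq inherits e as a left unit and q as a right unit.
  obtain ⟨k, hk, hk₀, hkk, h₁, h₂⟩ := exists_polar_phase (mul_mem (mul_mem he hy) hq) hne
  refine ⟨k, hk, hk₀, hkk, ?_, ?_⟩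
  · have := h₁ (1 - e) (by
      rw [sub_mul, one_mul, ← mul_assoc, ← mul_assoc, he'.isIdempotentElem.eq, sub_self])
    rw [sub_mul, one_mul, sub_eq_zero] at this
    exact this.symm
  · have := h₂ (1 - q) (by rw [mul_sub, mul_one, mul_assoc _ q q, hq'.isIdempotentElem.eq, sub_self])
    rw [mul_sub, mul_one, sub_eq_zero] at this
    exact this.symm

end Comparison

/-! ### In a type III factor, nonzero projections are equivalent to 1. -/

section InfiniteProjections

variable {H : Type*} [NormedAddCommGroup H] [InnerProductSpace ℂ H] [CompleteSpace H]

open ContinuousLinearMap InnerProductSpace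

/-- A family of partial isometries in `M` with range below `e` and orthogonal initial spaces. -/
def IsSubequivalentFamily (M : VonNeumannAlgebra H) (e : H →L[ℂ] H) (K : Set (H →L[ℂ] H)) : Prop :=
  (∀ k ∈ K, k ∈ M ∧ k ≠ 0 ∧ IsStarProjection (star k * k) ∧ e * k = k) ∧
    ∀ k ∈ K, ∀ l ∈ K, k ≠ l → k * star l = 0

theorem exists_maximal_isSubequivalentFamily (M : VonNeumannAlgebra H) (e : H →L[ℂ] H) :
    ∃ K, Maximal (IsSubequivalentFamily M e) K := by
  refine zorn_subset {K | IsSubequivalentFamily M e K} fun c hc hchain =>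
    ⟨⋃₀ c, ⟨?_, ?_⟩, fun s hs => Set.subset_sUnion_of_mem hs⟩
  · rintro k ⟨s, hs, hk⟩
    exact (hc hs).1 k hk
  · rintro k ⟨s, hs, hk⟩ l ⟨t, ht, hl⟩ hkl
    rcases hchain.total hs ht with h | h
    · exact (hc ht).2 k (h hk) l hl hkl
    · exact (hc hs).2 k hk l (h hl) hkl

/-- The sets {ξ : ‖ξ‖² < 2‖kξ‖²} are open and nonempty. They are disjoint because ‖kξ‖² + ‖lξ‖² ≤
‖ξ‖² for orthogonal initial spaces, so separability leaves only countably many. -/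
theorem IsSubequivalentFamily.countable [TopologicalSpace.SeparableSpace H]
    {M : VonNeumannAlgebra H} {e : H →L[ℂ] H} {K : Set (H →L[ℂ] H)}
    (hK : IsSubequivalentFamily M e K) : K.Countable := by
  refine Set.PairwiseDisjoint.countable_of_isOpen
    (s := fun k : H →L[ℂ] H => {ξ : H | ‖ξ‖ ^ 2 < 2 * ‖k ξ‖ ^ 2}) ?_ ?_ ?_
  · intro k hk l hl hkl
    refine Set.disjoint_left.2 fun ξ (h₁ : ‖ξ‖ ^ 2 < 2 * ‖k ξ‖ ^ 2) (h₂ : ‖ξ‖ ^ 2 < 2 * ‖l ξ‖ ^ 2) => ?_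
    have hkl₀ : star k * k * (star l * l) = 0 := by
      rw [mul_assoc, ← mul_assoc k, hK.2 k hk l hl hkl, zero_mul, mul_zero]
    have hp : IsStarProjection (star k * k + star l * l) :=
      (hK.1 k hk).2.2.1.add (hK.1 l hl).2.2.1 hkl₀
    have h₃ : ‖(star k * k + star l * l) ξ‖ ≤ ‖ξ‖ := by
      refine (le_opNorm _ _).trans ?_
      exact mul_le_of_le_one_left (norm_nonneg _) hp.norm_le
    have h₄ : (inner ℂ ((star k * k + star l * l) ξ) ξ : ℂ) = ((‖k ξ‖ ^ 2 + ‖l ξ‖ ^ 2 : ℝ) : ℂ) := by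
      change inner ℂ ((star k) (k ξ) + (star l) (l ξ)) ξ = _
      rw [inner_add_left, star_apply_inner, star_apply_inner, inner_self_eq_norm_sq_to_K,
        inner_self_eq_norm_sq_to_K]
      push_cast
      rfl
    have h₅ : ‖k ξ‖ ^ 2 + ‖l ξ‖ ^ 2 ≤ ‖ξ‖ * ‖ξ‖ := by
      have := norm_inner_le_norm (𝕜 := ℂ) ((star k * k + star l * l) ξ) ξ
      rw [h₄, Complex.norm_real, Real.norm_of_nonneg (by positivity)] at this
      exact this.trans (mul_le_mul_of_nonneg_right h₃ (norm_nonneg _))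
    nlinarith
  · intro k _
    exact isOpen_lt (by fun_prop) (by fun_prop)
  · intro k hk
    obtain ⟨-, hk₀, hkk, -⟩ := hK.1 k hk
    obtain ⟨ξ, hξ⟩ : ∃ ξ, k ξ ≠ 0 := by
      by_contra! h'
      exact hk₀ (ContinuousLinearMap.ext h')
    -- On the initial space k is isometric, so any nonzero vector there satisfies the strict
    -- inequality.
    refine ⟨(star k * k) ξ, ?_⟩
    set z := (star k * k) ξ with hz
    have hkz : k z = k ξ :=
      congrArg (fun z : H →L[ℂ] H => z ξ) (mul_star_mul_self_of_isStarProjection hkk)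
    have hzz : ‖z‖ ≤ ‖k ξ‖ := by
      have h₁ : (inner ℂ z z : ℂ) = inner ℂ (k ξ) (k z) := by
        conv_lhs => rw [hz]
        exact star_apply_inner k (k ξ) z
      rw [hkz, inner_self_eq_norm_sq_to_K, inner_self_eq_norm_sq_to_K] at h₁
      have h2 : ‖z‖ ^ 2 = ‖k ξ‖ ^ 2 := by exact_mod_cast h₁
      exact ((sq_eq_sq₀ (norm_nonneg _) (norm_nonneg _)).1 h2).le
    have : 0 < ‖k ξ‖ := norm_pos_iff.2 hξ
    change ‖z‖ ^ 2 < 2 * ‖k z‖ ^ 2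
    rw [hkz]
    nlinarith [norm_nonneg z]

/-- The linear map `(ξ_k) ↦ ∑ A_k ξ_k` on finitely supported families. -/
noncomputable def finsuppSum {H : Type*} [NormedAddCommGroup H] [InnerProductSpace ℂ H]
    {I : Type*} (A : I → H →L[ℂ] H) : (I →₀ H) →ₗ[ℂ] H :=
  Finsupp.lsum ℂ fun i => (A i : H →ₗ[ℂ] H)

theorem finsuppSum_apply {H : Type*} [NormedAddCommGroup H] [InnerProductSpace ℂ H]
    {I : Type*} (A : I → H →L[ℂ] H) (f : I →₀ H) :
    finsuppSum A f = ∑ i ∈ f.support, A i (f i) := by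
  simp [finsuppSum, Finsupp.sum]

theorem finsuppSum_single {H : Type*} [NormedAddCommGroup H] [InnerProductSpace ℂ H]
    {I : Type*} (A : I → H →L[ℂ] H) (i : I) (ξ : H) :
    finsuppSum A (Finsupp.single i ξ) = A i ξ := by
  simp [finsuppSum]

/-- The norm of a sum ∑ C i (f i) depends only on the operators C j* C i. -/
theorem norm_finsuppSum_eq {I : Type*} {A B : I → H →L[ℂ] H}
    (h : ∀ i j, star (A i) * A j = star (B i) * B j) (f : I →₀ H) :
    ‖finsuppSum B f‖ = ‖finsuppSum A f‖ := by
  have key : ∀ C : I → H →L[ℂ] H, (inner ℂ (finsuppSum C f) (finsuppSum C f) : ℂ) =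
      ∑ i ∈ f.support, ∑ j ∈ f.support, inner ℂ (f j) ((star (C j) * C i) (f i)) := fun C => by
    rw [finsuppSum_apply, inner_sum]
    refine Finset.sum_congr rfl fun i _ => ?_
    rw [sum_inner]
    refine Finset.sum_congr rfl fun j _ => ?_
    change inner ℂ ((C j) (f j)) ((C i) (f i)) = inner ℂ (f j) ((star (C j)) ((C i) (f i)))
    rw [← star_apply_inner (star (C j)), star_star]
  have h₁ : (inner ℂ (finsuppSum B f) (finsuppSum B f) : ℂ) =
      inner ℂ (finsuppSum A f) (finsuppSum A f) := by
    rw [key, key]; simp only [h]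
  rw [inner_self_eq_norm_sq_to_K, inner_self_eq_norm_sq_to_K] at h₁
  have h2 : ‖finsuppSum B f‖ ^ 2 = ‖finsuppSum A f‖ ^ 2 := by exact_mod_cast h₁
  exact (sq_eq_sq₀ (norm_nonneg _) (norm_nonneg _)).1 h2

/-- Supplies the equivariance under the commutant that `exists_partialIsometry` asks for. -/
theorem finsuppSum_mapRange {H : Type*} [NormedAddCommGroup H] [InnerProductSpace ℂ H]
    {I : Type*} {A : I → H →L[ℂ] H} {y : H →L[ℂ] H}
    (h : ∀ i, y * A i = A i * y) (f : I →₀ H) :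
    finsuppSum A (Finsupp.mapRange.linearMap (y : H →ₗ[ℂ] H) f) = y (finsuppSum A f) := by
  induction f using Finsupp.induction_linear with
  | zero => simp
  | add f g hf hg => rw [map_add, map_add, hf, hg, map_add, map_add]
  | single i ξ =>
    rw [Finsupp.mapRange.linearMap_apply, Finsupp.mapRange_single, finsuppSum_single,
      finsuppSum_single]
    exact (congrArg (fun z : H →L[ℂ] H => z ξ) (h i)).symm

/-- A maximal family of partial isometries into `e` exhausts the space. -/
theorem closure_range_finsuppSum_eq_top {M : VonNeumannAlgebra H} (hM : IsFactor M)
    {e : H →L[ℂ] H} (he : e ∈ M) (he' : IsStarProjection e) (he₀ : e ≠ 0)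
    {K : Set (H →L[ℂ] H)} (hK : Maximal (IsSubequivalentFamily M e) K) :
    (LinearMap.range (finsuppSum fun k : K => star k.1 * k.1)).topologicalClosure = ⊤ := by
  set a := finsuppSum fun k : K => star k.1 * k.1 with ha
  have hMk : ∀ k : K, star k.1 * k.1 ∈ M := fun k =>
    mul_mem (star_mem (hK.prop.1 k.1 k.2).1) (hK.prop.1 k.1 k.2).1
  have hPM : (LinearMap.range a).topologicalClosure.starProjection ∈ M := by
    have := starProjection_closure_span_mem M (LinearMap.range a : Set H) (by
      rintro y hy _ ⟨f, rfl⟩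
      exact ⟨_, finsuppSum_mapRange (fun k => mul_comm_of_mem_commutant (hMk k) hy) f⟩)
    rwa [Submodule.span_eq] at this
  set P := (LinearMap.range a).topologicalClosure.starProjection with hP
  have hPP : IsStarProjection P := isStarProjection_starProjection
  have hPk : ∀ k ∈ K, P * star k = star k := fun k hk => by
    have h₁ : P * (star k * k) = star k * k := ContinuousLinearMap.ext fun ξ => by
      change P ((star k * k) ξ) = (star k * k) ξ
      rw [Submodule.starProjection_eq_self_iff]
      refine Submodule.le_topologicalClosure _ ⟨Finsupp.single ⟨k, hk⟩ ξ, ?_⟩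
      rw [ha, finsuppSum_single]
    have h₂ := congrArg star (mul_star_mul_self_of_isStarProjection (hK.prop.1 k hk).2.2.1)
    rw [star_mul, star_mul, star_star] at h₂
    rw [← h₂, ← mul_assoc, h₁]
  by_cases hq : 1 - P = 0
  · rw [eq_top_iff]
    intro z _
    rw [← Submodule.starProjection_eq_self_iff]
    exact congrArg (fun x : H →L[ℂ] H => x z) (sub_eq_zero.1 hq).symm
  · exfalso
    -- If 1 - P ≠ 0, comparison gives a partial isometry into e supported under 1 - P. It can be
    -- added to K, so by maximality it is already in K, hence kk* = 0.
    obtain ⟨k, hkM, hk₀, hkk, hek, hkq⟩ := exists_partialIsometry_between hM he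
      (sub_mem (one_mem M) hPM) he' hPP.one_sub he₀ hq
    have hkl : ∀ l ∈ K, k * star l = 0 := fun l hl => by
      rw [← hkq, mul_assoc, sub_mul, one_mul, hPk l hl, sub_self, mul_zero]
    have hins : IsSubequivalentFamily M e (insert k K) := by
      refine ⟨?_, ?_⟩
      · rintro l (rfl | hl)
        · exact ⟨hkM, hk₀, hkk, hek⟩
        · exact hK.prop.1 l hl
      · rintro l (rfl | hl) m (rfl | hm) hlm
        · exact absurd rfl hlm
        · exact hkl m hm
        · have := congrArg star (hkl l hl)
          rwa [star_mul, star_star, star_zero] at this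
        · exact hK.prop.2 l hl m hm hlm
    have hmem : k ∈ K := hK.le_of_ge hins (Set.subset_insert k K) (Set.mem_insert k K)
    have h₁ := hkl k hmem
    rw [CStarRing.mul_star_self_eq_zero_iff] at h₁
    exact hk₀ h₁

section WanderingProjections

variable {p u : H →L[ℂ] H}

theorem mul_eq_self_of_mul_range (hu : star u * u = p) (hp : IsStarProjection p)
    (hpu : p * (u * star u) = u * star u) : p * u = u := by
  have h := mul_star_mul_self_of_isStarProjection (hu ▸ hp : IsStarProjection (star u * u))
  calc p * u = p * (u * (star u * u)) := by rw [h]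
    _ = p * (u * star u) * u := by simp only [mul_assoc]
    _ = u := by rw [hpu, mul_assoc, h]

/-- The exponent starts at 1 because u⁰ = 1 would give 1 instead of p. -/
theorem star_pow_mul_pow (hu : star u * u = p) (hpu : p * u = u) (n : ℕ) :
    star (u ^ (n + 1)) * u ^ (n + 1) = p := by
  induction n with
  | zero => simpa using hu
  | succ n ih =>
    rw [pow_succ' u (n + 1), star_mul, mul_assoc, ← mul_assoc (star u), hu, ← mul_assoc,
      mul_assoc (star _), pow_succ' u n, ← mul_assoc p, hpu, ← pow_succ' u n, ih]

/-- The translates of a wandering projection under the powers of `u` are orthogonal. -/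
theorem wandering_mul (hu : star u * u = p) (hpu : p * u = u) {e : H →L[ℂ] H}
    (he : IsStarProjection e) (hpe : p * e = e) (heu : e * u = 0) (n m : ℕ) :
    e * star (u ^ n) * (u ^ m * e) = if n = m then e else 0 := by
  have hsp : ∀ n, star (u ^ n) * u ^ n * e = e := fun n => by
    cases n with
    | zero => simp
    | succ n => rw [star_pow_mul_pow hu hpu, hpe]
  have hlt : ∀ n j, e * star (u ^ n) * (u ^ (n + (j + 1)) * e) = 0 := fun n j => by
    cases n with
    | zero =>
      rw [pow_zero, star_one, mul_one, zero_add, pow_succ', mul_assoc, ← mul_assoc e, heu, zero_mul]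
    | succ n =>
      calc _ = e * (star (u ^ (n + 1)) * u ^ (n + 1)) * (u ^ (j + 1) * e) := by
            rw [pow_add u (n + 1) (j + 1)]; simp only [mul_assoc]
        _ = e * (p * u) * (u ^ j * e) := by
            rw [star_pow_mul_pow hu hpu, pow_succ']; simp only [mul_assoc]
        _ = 0 := by rw [hpu, heu, zero_mul]
  rcases lt_trichotomy n m with h | rfl | h
  · obtain ⟨j, rfl⟩ := Nat.exists_eq_add_of_lt h
    rw [if_neg (by omega), add_assoc]
    exact hlt n j
  · rw [if_pos rfl, mul_assoc, ← mul_assoc (star _), hsp, he.isIdempotentElem.eq]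
  · obtain ⟨j, rfl⟩ := Nat.exists_eq_add_of_lt h
    rw [if_neg (by omega), add_assoc]
    have := congrArg star (hlt m j)
    simpa only [star_mul, star_star, he.isSelfAdjoint.star_eq, star_zero, mul_assoc] using this

end WanderingProjections

/-- In a factor on a separable space, `1` is equivalent to a subprojection of every infinite
projection. -/
theorem exists_isometry_into [TopologicalSpace.SeparableSpace H] {M : VonNeumannAlgebra H}
    (hM : IsFactor M) {p : H →L[ℂ] H} (hpM : p ∈ M) (hp : IsStarProjection p)
    (hinf : IsInfiniteProjection M p) : ∃ s ∈ M, star s * s = 1 ∧ p * s = s := by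
  obtain ⟨u, huM, hu, hpuu, hne⟩ := hinf
  have hpu : p * u = u := mul_eq_self_of_mul_range hu hp hpuu
  have hup : u * p = u := hu ▸ mul_star_mul_self_of_isStarProjection (hu ▸ hp)
  -- This projection is wandering: the operators uⁿe have orthogonal ranges below p, which gives
  -- infinitely many copies of e inside p.
  set e := p - u * star u with he
  have hsup : star u * p = star u := by
    have := congrArg star hpu
    rwa [star_mul, hp.isSelfAdjoint.star_eq] at this
  have hpe : p * e = e := by rw [he, mul_sub, hp.isIdempotentElem.eq, hpuu]
  have heu : e * u = 0 := by rw [he, sub_mul, hpu, mul_assoc, hu, hup, sub_self]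
  have hep : e * p = e := by rw [he, sub_mul, hp.isIdempotentElem.eq, mul_assoc, hsup]
  have hee : IsStarProjection e := by
    refine ⟨?_, hp.isSelfAdjoint.sub (IsSelfAdjoint.mul_star_self u)⟩
    change e * e = e
    nth_rw 2 [he]
    rw [mul_sub, hep, ← mul_assoc, heu, zero_mul, sub_zero]
  have heM : e ∈ M := sub_mem hpM (mul_mem huM (star_mem huM))
  have he₀ : e ≠ 0 := fun h => hne (sub_eq_zero.1 h).symm
  obtain ⟨K, hK⟩ := exists_maximal_isSubequivalentFamily M e
  have : Countable K := hK.prop.countable.to_subtype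
  obtain ⟨ν, hν⟩ := exists_injective_nat K
  let A : K → H →L[ℂ] H := fun k => star k.1 * k.1
  -- The initial spaces of the k ∈ K fill H; `B k` sends that of k into the copy of e numbered ν k.
  -- The isometry s glues these maps by A k ξ ↦ B k ξ.
  let B : K → H →L[ℂ] H := fun k => u ^ ν k * k.1
  have hAM : ∀ k, A k ∈ M := fun k =>
    mul_mem (star_mem (hK.prop.1 k.1 k.2).1) (hK.prop.1 k.1 k.2).1
  have hBM : ∀ k, B k ∈ M := fun k => mul_mem (pow_mem huM _) (hK.prop.1 k.1 k.2).1
  have hAB : ∀ k l, star (A k) * A l = star (B k) * B l := fun k l => by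
    have hk := (hK.prop.1 k.1 k.2).2.2
    have hl := (hK.prop.1 l.1 l.2).2.2
    have h₁ : star (B k) * B l = star k.1 * (e * star (u ^ ν k) * (u ^ ν l * e)) * l.1 := by
      change star (u ^ ν k * k.1) * (u ^ ν l * l.1) = _
      nth_rw 1 [← hk.2, ← hl.2]
      simp only [star_mul, hee.isSelfAdjoint.star_eq, mul_assoc]
    have h₂ : star (A k) * A l = star k.1 * (k.1 * star l.1) * l.1 := by
      simp only [A, star_mul, star_star, mul_assoc]
    rw [h₁, h₂, wandering_mul hu hpu hee hpe heu]
    split_ifs with h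
    · obtain rfl := hν h
      rw [← mul_assoc, mul_assoc _ (star _), hk.1.isIdempotentElem.eq, mul_assoc, hk.2]
    · rw [hK.prop.2 k.1 k.2 l.1 l.2 (fun h' => h (congrArg ν (Subtype.ext h'))), mul_zero, zero_mul]
  obtain ⟨s, hsM, -, hss, hsc⟩ := exists_partialIsometry M (finsuppSum A) (finsuppSum B)
    (norm_finsuppSum_eq hAB) fun y hy =>
      ⟨_, finsuppSum_mapRange fun k => mul_comm_of_mem_commutant (hAM k) hy,
        finsuppSum_mapRange fun k => mul_comm_of_mem_commutant (hBM k) hy⟩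
  refine ⟨s, hsM, ?_, ?_⟩
  · have htop := closure_range_finsuppSum_eq_top hM heM hee he₀ hK
    rw [hss]
    ext z
    rw [Submodule.starProjection_eq_self_iff.2]
    · rfl
    · exact htop.ge trivial
  · have hpB : ∀ k, p * B k = B k := fun k => by
      have hk := (hK.prop.1 k.1 k.2).2.2.2
      have h : ∀ n, p * (u ^ n * e) = u ^ n * e := fun n => by
        cases n with
        | zero => simpa using hpe
        | succ n => rw [pow_succ', ← mul_assoc, ← mul_assoc, hpu]
      change p * (u ^ ν k * k.1) = u ^ ν k * k.1
      rw [← hk, ← mul_assoc (u ^ _), ← mul_assoc, h]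
    have h₁ := hsc (1 - p) fun f => by
      rw [finsuppSum_apply, map_sum]
      refine Finset.sum_eq_zero fun k _ => ?_
      have : (1 - p) * B k = 0 := by rw [sub_mul, one_mul, hpB, sub_self]
      exact congrArg (fun z : H →L[ℂ] H => z (f k)) this
    rw [sub_mul, one_mul, sub_eq_zero] at h₁
    exact h₁.symm

/-- Schröder–Bernstein: if `1` is equivalent to a subprojection of `p` then `1` is equivalent to
`p`. -/
theorem exists_isometry_onto_of_into {M : VonNeumannAlgebra H} {p s : H →L[ℂ] H} (hpM : p ∈ M)
    (hp : IsStarProjection p) (hsM : s ∈ M) (hss : star s * s = 1) (hps : p * s = s) :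
    ∃ t ∈ M, star t * t = 1 ∧ t * star t = p := by
  set f := 1 - p with hf
  have hfM : f ∈ M := sub_mem (one_mem M) hpM
  have hff : IsStarProjection f := hp.one_sub
  have hfs : f * s = 0 := by rw [hf, sub_mul, one_mul, hps, sub_self]
  have hsf : star s * f = 0 := by
    have := congrArg star hfs
    rwa [star_mul, hff.isSelfAdjoint.star_eq, star_zero] at this
  -- With g the projection onto the closed span of all sⁿfH, the isometry wanted is s on gH and the
  -- identity on its complement. Since s shifts the pieces sⁿfH, exactly fH is lost: sgs* = g - f,
  -- so the range projection is 1 - f = p.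
  set G : Set H := {z | ∃ n : ℕ, ∃ ξ, z = (s ^ n * f) ξ} with hG
  have hgM := starProjection_closure_span_mem M G (by
    rintro y hy _ ⟨n, ξ, rfl⟩
    refine ⟨n, y ξ, ?_⟩
    exact congrArg (fun z : H →L[ℂ] H => z ξ)
      (mul_comm_of_mem_commutant (mul_mem (pow_mem hsM n) hfM) hy))
  set K := (Submodule.span ℂ G).topologicalClosure with hK
  set g := K.starProjection with hg
  have hgg : IsStarProjection g := isStarProjection_starProjection
  have hGK : ∀ z ∈ G, g z = z := fun z hz =>
    Submodule.starProjection_eq_self_iff.2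
      (Submodule.le_topologicalClosure _ (Submodule.subset_span hz))
  have hext : ∀ {x y : H →L[ℂ] H}, (∀ n, x * (s ^ n * f) = y * (s ^ n * f)) → x * g = y * g := by
    intro x y h
    ext ξ
    change x (g ξ) = y (g ξ)
    refine eqOn_closure_span (s := G) ?_ (Submodule.starProjection_apply_mem K ξ)
    rintro _ ⟨n, η, rfl⟩
    exact congrArg (fun z : H →L[ℂ] H => z η) (h n)
  have hgn : ∀ n, g * (s ^ n * f) = s ^ n * f := fun n =>
    ContinuousLinearMap.ext fun ξ => hGK _ ⟨n, ξ, rfl⟩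
  have hgf : g * f = f := by simpa using hgn 0
  have hfg : f * g = f := by
    have := congrArg star hgf
    rwa [star_mul, hff.isSelfAdjoint.star_eq, hgg.isSelfAdjoint.star_eq] at this
  have hgsg : g * s * g = s * g := hext fun n => by
    rw [mul_assoc, ← mul_assoc s, ← pow_succ', hgn]
  have hgsg' : g * star s * g = g * star s := by
    have := congrArg star hgsg
    simpa only [star_mul, hgg.isSelfAdjoint.star_eq, mul_assoc] using this
  have hshift : (g - s * g * star s) * g = f * g := hext fun n => by
    cases n with
    | zero => rw [pow_zero, one_mul, sub_mul, mul_assoc _ (star s), hsf, mul_zero, sub_zero, hgf,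
        hff.isIdempotentElem.eq]
    | succ n =>
      rw [sub_mul, hgn, pow_succ', mul_assoc s, mul_assoc _ (star s), ← mul_assoc (star s), hss,
        one_mul, mul_assoc, hgn, sub_self, ← mul_assoc, hfs, zero_mul]
  have hsgs : s * g * star s = g - f := by
    rw [sub_mul, hgg.isIdempotentElem.eq, hfg, mul_assoc s, mul_assoc s, hgsg', ← mul_assoc] at hshift
    rw [← hshift, sub_sub_cancel]
  have hgh : g * (1 - g) = 0 := by rw [mul_sub, mul_one, hgg.isIdempotentElem.eq, sub_self]
  have hhg : (1 - g) * g = 0 := by rw [sub_mul, one_mul, hgg.isIdempotentElem.eq, sub_self]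
  have hhh : (1 - g) * (1 - g) = 1 - g := hgg.one_sub.isIdempotentElem.eq
  have hstar : star (s * g + (1 - g)) = g * star s + (1 - g) := by
    rw [star_add, star_mul, hgg.isSelfAdjoint.star_eq, hgg.one_sub.isSelfAdjoint.star_eq]
  have hhsg : (1 - g) * (s * g) = 0 := by rw [sub_mul, one_mul, ← mul_assoc, hgsg, sub_self]
  have hgsh : g * star s * (1 - g) = 0 := by rw [mul_sub, mul_one, hgsg', sub_self]
  refine ⟨s * g + (1 - g), add_mem (mul_mem hsM hgM) (sub_mem (one_mem M) hgM), ?_, ?_⟩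
  · rw [hstar, add_mul, mul_add, mul_add, hhsg, hgsh, hhh, mul_assoc g, ← mul_assoc (star s), hss,
      one_mul, hgg.isIdempotentElem.eq, add_zero, zero_add, add_sub_cancel]
  · rw [hstar, add_mul, mul_add, mul_add, hhh, mul_assoc s g (1 - g), hgh, mul_zero, ← mul_assoc (1 - g),
      hhg, zero_mul, mul_assoc s g, ← mul_assoc g g, hgg.isIdempotentElem.eq, ← mul_assoc, hsgs, hf]
    abel

/-- In a type III factor on a separable space, every nonzero projection is equivalent to `1`. -/
theorem IsTypeIIIFactor.exists_isometry_onto [TopologicalSpace.SeparableSpace H]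
    {M : VonNeumannAlgebra H} (hM : IsTypeIIIFactor M) {p : H →L[ℂ] H} (hpM : p ∈ M)
    (hp : IsStarProjection p) (hp₀ : p ≠ 0) : ∃ t ∈ M, star t * t = 1 ∧ t * star t = p := by
  obtain ⟨s, hsM, hss, hps⟩ := exists_isometry_into hM.1 hpM hp (hM.2 p hpM hp hp₀)
  exact exists_isometry_onto_of_into hpM hp hsM hss hps

end InfiniteProjections

/-! ### The conjugacy relations bound the length of orthogonal families. -/

section OrthogonalBound

variable {B : Type*} [Ring B] [StarRing B] [Algebra ℂ B]

/-- If `R ∈ Hom(id, γ²)`, the left inverse `b ↦ R* γ(b) R` maps `Hom(γ, γ)` into the center. -/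
theorem leftInverse_mem_center {γ : B →⋆ₐ[ℂ] B} {R : B} (hR : ∀ b, R * b = γ (γ b) * R)
    (hstarR : ∀ b, star R * γ (γ b) = b * star R) {x : B} (hx : x ∈ Hom γ γ) :
    star R * γ x * R ∈ Hom (StarAlgHom.id ℂ B) (StarAlgHom.id ℂ B) := by
  intro b
  change star R * γ x * R * b = b * (star R * γ x * R)
  calc star R * γ x * R * b = star R * (γ x * γ (γ b)) * R := by
        rw [mul_assoc, hR]; simp only [mul_assoc]
    _ = star R * γ (γ b) * γ x * R := by
        rw [← map_mul, hx b, map_mul]; simp only [mul_assoc]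
    _ = b * (star R * γ x * R) := by
        rw [hstarR]; simp only [mul_assoc]

/-- If `R ∈ Hom(id, γ²)` solves the conjugacy relations of a self-conjugate `γ` and `R* R = D`, then
pairwise orthogonal nonzero self-adjoint elements of `Hom(γ, γ)` number at most `D²`. -/
theorem card_orthogonal_le [StarModule ℂ B] {γ : B →⋆ₐ[ℂ] B} {R : B}
    (hR : ∀ b, R * b = γ (γ b) * R) (hRγ : star R * γ R = 1) {D : ℝ}
    (hRR : star R * R = (D : ℂ) • (1 : B))
    (hcenter : ∀ z ∈ Hom (StarAlgHom.id ℂ B) (StarAlgHom.id ℂ B), ∃ c : ℂ, z = c • (1 : B))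
    (hpos : ∀ (y : B) (c : ℂ), star y * y = c • (1 : B) → ∃ r : ℝ, 0 ≤ r ∧ c = r)
    (hfaith : ∀ y : B, star y * y = 0 → y = 0)
    {n : ℕ} (a : Fin n → B) (ha : ∀ i, a i ∈ Hom γ γ)
    (hsa : ∀ i, star (a i) = a i) (ha₀ : ∀ i, a i ≠ 0) (horth : ∀ i j, i ≠ j → a i * a j = 0) :
    (n : ℝ) ≤ D ^ 2 := by
  have hstarR : ∀ b, star R * γ (γ b) = b * star R := fun b => by
    have := congrArg star (hR (star b))
    simpa only [star_mul, star_star, map_star] using this.symm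
  -- Frobenius reciprocity: b is recovered from γ(b)R.
  have hrec : ∀ b, star R * γ (γ b * R) = b := fun b => by
    rw [map_mul, ← mul_assoc, hstarR, mul_assoc, hRγ, mul_one]
  have hex : ∀ i, ∃ r : ℝ, r ≠ 0 ∧ star R * γ (a i * a i) * R = (r : ℂ) • (1 : B) := fun i => by
    obtain ⟨c, hc⟩ := hcenter _ (leftInverse_mem_center hR hstarR
      (x := a i * a i) (comp ⟨a i, ha i⟩ ⟨a i, ha i⟩).2)
    have hc' : star (γ (a i) * R) * (γ (a i) * R) = c • (1 : B) := by
      rw [← hc, star_mul, ← map_star, hsa, map_mul]; simp only [mul_assoc]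
    obtain ⟨r, -, rfl⟩ := hpos _ _ hc'
    refine ⟨r, ?_, hc⟩
    rintro rfl
    rw [Complex.ofReal_zero, zero_smul] at hc'
    have := hrec (a i)
    rw [hfaith _ hc', map_zero, mul_zero] at this
    exact ha₀ i this.symm
  choose r hr₀ hr using hex
  set T : Fin n → B := fun i => γ (a i) * R with hT
  have hTT : ∀ i j, star (T i) * T j = if i = j then (r i : ℂ) • (1 : B) else 0 := fun i j => by
    have h₁ : star (T i) * T j = star R * γ (a i * a j) * R := by
      simp only [hT, star_mul, ← map_star, hsa, map_mul, mul_assoc]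
    rw [h₁]
    split_ifs with hij
    · rw [← hij, hr]
    · rw [horth i j hij, map_zero, mul_zero, zero_mul]
  -- The T i are orthogonal multiples of isometries, with T i* T i = r i, so Q is the sum of their
  -- range projections.
  set Q : B := ∑ i, ((r i)⁻¹ : ℂ) • (T i * star (T i)) with hQ
  have hQs : star Q = Q := by
    rw [hQ, star_sum]
    refine Finset.sum_congr rfl fun i _ => ?_
    rw [star_smul, star_mul, star_star]
    congr 1
    simp
  have hQT : ∀ j, Q * T j = T j := fun j => by
    rw [hQ, Finset.sum_mul, Finset.sum_eq_single j]
    · rw [smul_mul_assoc, mul_assoc, hTT, if_pos rfl, mul_smul_comm, smul_smul, mul_one,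
        inv_mul_cancel₀ (by exact_mod_cast hr₀ j), one_smul]
    · intro i _ hij
      rw [smul_mul_assoc, mul_assoc, hTT, if_neg hij, mul_zero, smul_zero]
    · simp
  have hQQ : Q * Q = Q := by
    conv_lhs => arg 2; rw [hQ]
    rw [Finset.mul_sum]
    refine Finset.sum_congr rfl fun i _ => ?_
    rw [mul_smul_comm, ← mul_assoc, hQT]
  have hQ₁ : star (1 - Q) * (1 - Q) = 1 - Q := by
    rw [star_sub, star_one, hQs, sub_mul, mul_sub Q, hQQ, one_mul, mul_one, sub_self, sub_zero]
  -- Applying R*γ(·)R to 1 - Q gives D - ∑ (r i)⁻¹(a i)². A second application gives the scalar D² -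
  -- n, which has the form y*y and is therefore nonnegative.
  have hZ : star (γ (1 - Q) * R) * (γ (1 - Q) * R) =
      ((D : ℂ)) • 1 - ∑ i, ((r i)⁻¹ : ℂ) • (a i * a i) := by
    have h₁ : star (γ (1 - Q) * R) * (γ (1 - Q) * R) = star R * γ (star (1 - Q) * (1 - Q)) * R := by
      simp only [star_mul, map_star, map_mul, mul_assoc]
    rw [h₁, hQ₁, map_sub, map_one, mul_sub, sub_mul, mul_one, hRR, hQ, map_sum, Finset.mul_sum,
      Finset.sum_mul]
    congr 1
    refine Finset.sum_congr rfl fun i _ => ?_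
    rw [map_smul, mul_smul_comm, smul_mul_assoc]
    congr 1
    calc star R * γ (T i * star (T i)) * R = star R * γ (T i) * star (star R * γ (T i)) := by
          simp only [star_mul, star_star, map_star, map_mul, mul_assoc]
      _ = a i * a i := by rw [hrec, hsa]
  set Z := γ (1 - Q) * R with hZdef
  have hW : star (γ Z * R) * (γ Z * R) = ((D : ℂ) ^ 2 - n) • (1 : B) := by
    have h₁ : star (γ Z * R) * (γ Z * R) = star R * γ (star Z * Z) * R := by
      simp only [star_mul, map_star, map_mul, mul_assoc]
    rw [h₁, hZ, map_sub, map_smul, map_one, mul_sub, sub_mul, mul_smul_comm, mul_one,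
      smul_mul_assoc, hRR, smul_smul, map_sum, Finset.mul_sum, Finset.sum_mul]
    have h₂ : ∀ i, star R * γ (((r i)⁻¹ : ℂ) • (a i * a i)) * R = 1 := fun i => by
      rw [map_smul, mul_smul_comm, smul_mul_assoc, hr, smul_smul,
        inv_mul_cancel₀ (by exact_mod_cast hr₀ i), one_smul]
    rw [Finset.sum_congr rfl fun i _ => h₂ i, Finset.sum_const, Finset.card_univ, Fintype.card_fin,
      sub_smul, ← pow_two, ← Nat.cast_smul_eq_nsmul ℂ]
  obtain ⟨s, hs, hsn⟩ := hpos _ _ hW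
  have : D ^ 2 - n = s := by exact_mod_cast hsn
  linarith

end OrthogonalBound

/-! ### Decomposition of a homomorphism along minimal projections. -/

section Decomposition

variable {A B : Type*} [Ring A] [StarRing A] [Algebra ℂ A] [Ring B] [StarRing B] [Algebra ℂ B]

/-- The compression `t* φ(·) t` of `φ` by an isometry `t` whose range projection commutes with the
range of `φ`. -/
def compression (φ : A →⋆ₐ[ℂ] B) (t : B) (ht : star t * t = 1)
    (hp : t * star t ∈ Hom φ φ) : A →⋆ₐ[ℂ] B where
  toFun a := star t * φ a * t
  map_one' := by rw [map_one, mul_one, ht]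
  map_mul' a b := by
    have h : φ a * (t * star t) = t * star t * φ a := (hp a).symm
    calc star t * φ (a * b) * t = star t * t * star t * φ a * φ b * t := by
          rw [ht, one_mul, map_mul]; simp only [mul_assoc]
      _ = star t * (t * star t * φ a) * φ b * t := by simp only [mul_assoc]
      _ = _ := by rw [← h]; simp only [mul_assoc]
  map_zero' := by rw [map_zero, mul_zero, zero_mul]
  map_add' a b := by rw [map_add, mul_add, add_mul]
  commutes' c := by
    rw [AlgHomClass.commutes, ← Algebra.commutes, mul_assoc, ht, mul_one]
  map_star' a := by
    rw [map_star]; simp only [star_mul, star_star, mul_assoc]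

/-- Commutativity of `Hom(φ, φ)` makes a decomposition along minimal projections
multiplicity-free. -/
theorem isMultiplicityFree_of_minimal [Nontrivial B] {φ : A →⋆ₐ[ℂ] B}
    (hcomm : ∀ x ∈ Hom φ φ, ∀ y ∈ Hom φ φ, x * y = y * x) {n : ℕ} (t : Fin n → B)
    (ht : ∀ i, star (t i) * t i = 1) (hmem : ∀ i, t i * star (t i) ∈ Hom φ φ)
    (hsum : ∑ i, t i * star (t i) = 1)
    (horth : ∀ i j, i ≠ j → t i * star (t i) * (t j * star (t j)) = 0)
    (hmin : ∀ x ∈ Hom φ φ, ∀ i, ∃ c : ℂ, x * (t i * star (t i)) = c • (t i * star (t i))) :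
    IsMultiplicityFree φ := by
  have hφ : ∀ i a, φ a * t i = t i * (star (t i) * φ a * t i) := fun i a => by
    have h : t i * star (t i) * φ a = φ a * (t i * star (t i)) := hmem i a
    calc φ a * t i = φ a * (t i * star (t i)) * t i := by
          rw [mul_assoc, mul_assoc, ht, mul_one]
      _ = _ := by rw [← h]; simp only [mul_assoc]
  have hφ' : ∀ i a, star (t i) * φ a = (star (t i) * φ a * t i) * star (t i) := fun i a => by
    have h : t i * star (t i) * φ a = φ a * (t i * star (t i)) := hmem i a
    calc star (t i) * φ a = star (t i) * (t i * star (t i) * φ a) := by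
          rw [← mul_assoc, ← mul_assoc, ht, one_mul]
      _ = _ := by rw [h]; simp only [mul_assoc]
  -- Intertwiners between compressions lift to Hom(φ,φ); both irreducibility and inequivalence are
  -- tested on these lifts.
  have hlift : ∀ i j (s : B), (∀ a, s * (star (t i) * φ a * t i) = (star (t j) * φ a * t j) * s) →
      t j * s * star (t i) ∈ Hom φ φ := fun i j s hs a => by
    calc t j * s * star (t i) * φ a = t j * s * (star (t i) * φ a) := by rw [mul_assoc]
      _ = t j * (s * (star (t i) * φ a * t i)) * star (t i) := by
          conv_lhs => rw [hφ']
          simp only [mul_assoc]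
      _ = t j * (star (t j) * φ a * t j) * s * star (t i) := by rw [hs]; simp only [mul_assoc]
      _ = φ a * (t j * s * star (t i)) := by rw [← hφ]; simp only [mul_assoc]
  refine ⟨n, fun i => compression φ (t i) (ht i) (hmem i), ⟨t, ht, hsum, fun a => ?_⟩,
    fun i => ⟨inferInstance, fun s => ?_⟩, fun i j hij => ?_⟩
  · change φ a = ∑ i, t i * (star (t i) * φ a * t i) * star (t i)
    calc φ a = ∑ i, φ a * (t i * star (t i)) := by rw [← Finset.mul_sum, hsum, mul_one]
      _ = _ := Finset.sum_congr rfl fun i _ => by rw [← hφ, mul_assoc]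
  · obtain ⟨c, hc⟩ := hmin _ (hlift i i s s.2) i
    refine ⟨c, Subtype.ext ?_⟩
    change (s : B) = c • (1 : B)
    calc (s : B) = star (t i) * t i * s * (star (t i) * t i) * (star (t i) * t i) := by
          rw [ht, one_mul, mul_one, mul_one]
      _ = star (t i) * (t i * s * star (t i) * (t i * star (t i))) * t i := by
          simp only [mul_assoc]
      _ = c • (star (t i) * t i * (star (t i) * t i)) := by
          rw [hc, mul_smul_comm, smul_mul_assoc]; simp only [mul_assoc]
      _ = c • 1 := by rw [ht, mul_one]
  · rintro ⟨u, hu, -⟩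
    have hu' : star (u : B) * (u : B) = 1 := congrArg Subtype.val hu
    have hX := hlift i j u u.2
    -- The lift X satisfies X = pⱼX = Xpⱼ by commutativity, and Xpⱼ = Xpᵢpⱼ = 0.
    have h₀ : t j * u * star (t i) = 0 := by
      calc t j * u * star (t i) = t j * (star (t j) * t j) * u * star (t i) := by rw [ht, mul_one]
        _ = t j * star (t j) * (t j * u * star (t i)) := by simp only [mul_assoc]
        _ = t j * u * (star (t i) * t i * star (t i)) * (t j * star (t j)) := by
            rw [hcomm _ (hmem j) _ hX, ht, one_mul]
        _ = t j * u * star (t i) * (t i * star (t i) * (t j * star (t j))) := by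
            simp only [mul_assoc]
        _ = 0 := by rw [horth i j hij, mul_zero]
    have h₁ : (u : B) = 0 := by
      calc (u : B) = star (t j) * t j * u * (star (t i) * t i) := by
            rw [ht, ht, one_mul, mul_one]
        _ = star (t j) * (t j * u * star (t i)) * t i := by simp only [mul_assoc]
        _ = 0 := by rw [h₀, mul_zero, zero_mul]
    rw [h₁, mul_zero] at hu'
    exact zero_ne_one hu'

end Decomposition

/-! ### Application to the canonical endomorphism of a type III factor. -/

section FactorEndomorphisms

variable {H : Type*} [NormedAddCommGroup H] [InnerProductSpace ℂ H] [CompleteSpace H]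
  {M : VonNeumannAlgebra H}

open ContinuousLinearMap

theorem IsFactor.exists_eq_smul_one (hM : IsFactor M) (z : M.toStarSubalgebra)
    (hz : z ∈ Hom (StarAlgHom.id ℂ M.toStarSubalgebra) (StarAlgHom.id ℂ M.toStarSubalgebra)) :
    ∃ c : ℂ, z = c • (1 : M.toStarSubalgebra) := by
  obtain ⟨c, hc⟩ := hM.2 z z.2 (VonNeumannAlgebra.mem_commutant_iff.2 fun g hg =>
    (congrArg Subtype.val (hz ⟨g, hg⟩)).symm)
  exact ⟨c, Subtype.ext hc⟩

theorem exists_nonneg_of_star_mul_self_eq_smul [Nontrivial H] (y : M.toStarSubalgebra) (c : ℂ)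
    (hy : star y * y = c • (1 : M.toStarSubalgebra)) : ∃ r : ℝ, 0 ≤ r ∧ c = r := by
  obtain ⟨ξ, hξ⟩ := exists_ne (0 : H)
  have h₁ : (star (y : H →L[ℂ] H)) ((y : H →L[ℂ] H) ξ) = c • ξ :=
    congrArg (fun z : M.toStarSubalgebra => (z : H →L[ℂ] H) ξ) hy
  have h₂ := star_apply_inner (y : H →L[ℂ] H) ((y : H →L[ℂ] H) ξ) ξ
  rw [h₁, inner_smul_left, inner_self_eq_norm_sq_to_K, inner_self_eq_norm_sq_to_K] at h₂
  have hξ' : (‖ξ‖ : ℂ) ^ 2 ≠ 0 := pow_ne_zero _ (Complex.ofReal_ne_zero.2 (norm_ne_zero_iff.2 hξ))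
  refine ⟨‖(y : H →L[ℂ] H) ξ‖ ^ 2 / ‖ξ‖ ^ 2, by positivity, ?_⟩
  have h₃ := congrArg (starRingEnd ℂ) ((eq_div_iff hξ').2 h₂)
  rw [Complex.conj_conj] at h₃
  rw [h₃]
  simp

theorem eq_zero_of_star_mul_self_eq_zero (y : M.toStarSubalgebra) (hy : star y * y = 0) : y = 0 :=
  Subtype.ext ((CStarRing.star_mul_self_eq_zero_iff (y : H →L[ℂ] H)).1 (congrArg Subtype.val hy))

/-- `Hom(γ, γ)` as a `*`-algebra of operators: the commutant of `M' ∪ γ(M)`. -/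
noncomputable def homAlgebra (γ : M.toStarSubalgebra →⋆ₐ[ℂ] M.toStarSubalgebra) :
    StarSubalgebra ℂ (H →L[ℂ] H) :=
  StarSubalgebra.centralizer ℂ
    ((M.commutant : Set (H →L[ℂ] H)) ∪ Set.range fun m => (γ m : H →L[ℂ] H))

theorem mem_homAlgebra_iff_commute {γ : M.toStarSubalgebra →⋆ₐ[ℂ] M.toStarSubalgebra}
    {x : H →L[ℂ] H} :
    x ∈ homAlgebra γ ↔ (∀ y ∈ M.commutant, y * x = x * y) ∧
      ∀ m, (γ m : H →L[ℂ] H) * x = x * (γ m : H →L[ℂ] H) := by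
  rw [homAlgebra, StarSubalgebra.mem_centralizer_iff]
  constructor
  · exact fun h => ⟨fun y hy => (h y (Or.inl hy)).1, fun m => (h _ (Or.inr ⟨m, rfl⟩)).1⟩
  · rintro ⟨h₁, h₂⟩ g (hg | ⟨m, rfl⟩)
    · exact ⟨h₁ g hg, h₁ _ (star_mem hg)⟩
    · refine ⟨h₂ m, ?_⟩
      have := h₂ (star m)
      rwa [map_star] at this

theorem mem_homAlgebra_iff {γ : M.toStarSubalgebra →⋆ₐ[ℂ] M.toStarSubalgebra} {x : H →L[ℂ] H} :
    x ∈ homAlgebra γ ↔ ∃ y ∈ Hom γ γ, (y : H →L[ℂ] H) = x := by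
  rw [mem_homAlgebra_iff_commute, ← mem_iff_forall_commutant]
  constructor
  · rintro ⟨hx, h⟩
    exact ⟨⟨x, hx⟩, fun m => Subtype.ext (h m).symm, rfl⟩
  · rintro ⟨y, hy, rfl⟩
    exact ⟨y.2, fun m => (congrArg Subtype.val (hy m)).symm⟩

/-- Being a commutant, the algebra is closed under functional calculus: whatever commutes with b
commutes with b⁺. -/
theorem posPart_mem_homAlgebra {γ : M.toStarSubalgebra →⋆ₐ[ℂ] M.toStarSubalgebra} {b : H →L[ℂ] H}
    (hb : b ∈ homAlgebra γ) : b⁺ ∈ homAlgebra γ := by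
  rw [mem_homAlgebra_iff_commute] at hb ⊢
  have key : ∀ y : H →L[ℂ] H, y * b = b * y → y * b⁺ = b⁺ * y := fun y hy =>
    (Commute.cfcₙ_real (show Commute b y from hy.symm) _).symm
  exact ⟨fun y hy => key y (hb.1 y hy), fun m => key _ (hb.2 m)⟩

theorem isMultiplicityFree_canonicalEnd [TopologicalSpace.SeparableSpace H]
    (hM : IsTypeIIIFactor M) {A : Type*} [Ring A] [StarRing A] [Algebra ℂ A]
    {ι : A →⋆ₐ[ℂ] M.toStarSubalgebra} {ιbar : M.toStarSubalgebra →⋆ₐ[ℂ] A}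
    {w : Hom (StarAlgHom.id ℂ A) (dualCanonicalEnd ι ιbar)}
    {v : Hom (StarAlgHom.id ℂ M.toStarSubalgebra) (canonicalEnd ι ιbar)}
    (h : ConjugacyRelations ι ιbar w v) {d : ℝ} (hd : IsNormalized w v d)
    (hcomm : ∀ s₁ s₂ : Hom (canonicalEnd ι ιbar) (canonicalEnd ι ιbar),
      comp s₁ s₂ = comp s₂ s₁) :
    IsMultiplicityFree (canonicalEnd ι ιbar) := by
  have : Nontrivial H := hM.1.1
  have hc : ∀ x ∈ Hom (canonicalEnd ι ιbar) (canonicalEnd ι ιbar),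
      ∀ y ∈ Hom (canonicalEnd ι ιbar) (canonicalEnd ι ιbar), x * y = y * x := fun x hx y hy =>
    congrArg Subtype.val (hcomm ⟨x, hx⟩ ⟨y, hy⟩)
  have hRR : star (canonicalSolution w v) * canonicalSolution w v =
      ((d ^ 2 : ℝ) : ℂ) • (1 : M.toStarSubalgebra) := by
    rw [star_canonicalSolution_mul_self hd, Complex.ofReal_pow]
  obtain ⟨n, p, hpA, hpp, hp₀, horth, hsum, hmin⟩ := exists_minimal_projections
    (A := homAlgebra (canonicalEnd ι ιbar)) (by
      intro x hx y hy
      obtain ⟨x', hx', rfl⟩ := mem_homAlgebra_iff.1 hx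
      obtain ⟨y', hy', rfl⟩ := mem_homAlgebra_iff.1 hy
      exact congrArg Subtype.val (hc x' hx' y' hy'))
    -- The bound is D² with D = d², the value of R*R for R = ι(w)v.
    (fun b hb _ => posPart_mem_homAlgebra hb) ⌊(d ^ 2) ^ 2⌋₊ (by
      rintro n a ⟨haA, ha, ha₀, horth⟩
      choose b hb hba using fun i => mem_homAlgebra_iff.1 (haA i)
      refine Nat.le_floor (card_orthogonal_le canonicalSolution_mul
        (star_canonicalSolution_mul_map h) hRR hM.1.exists_eq_smul_one
        exists_nonneg_of_star_mul_self_eq_smul eq_zero_of_star_mul_self_eq_zero b hb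
        (fun i => Subtype.ext ?_) (fun i hi => ha₀ i ?_) fun i j hij => Subtype.ext ?_)
      · change star (b i : H →L[ℂ] H) = b i
        rw [hba]
        exact (IsSelfAdjoint.of_nonneg (ha i)).star_eq
      · rw [← hba, hi]; rfl
      · change (b i : H →L[ℂ] H) * (b j : H →L[ℂ] H) = 0
        rw [hba, hba, horth i j hij])
  choose q hq hqp using fun i => mem_homAlgebra_iff.1 (hpA i)
  have hpM : ∀ i, p i ∈ M := fun i => hqp i ▸ (q i).2
  -- Type III enters here: each minimal projection is the range projection of an isometry in M.
  choose t htM htt hts using fun i => hM.exists_isometry_onto (hpM i) (hpp i) (hp₀ i)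
  have hTq : ∀ i, (⟨t i, htM i⟩ : M.toStarSubalgebra) * star ⟨t i, htM i⟩ = q i := fun i =>
    Subtype.ext ((hts i).trans (hqp i).symm)
  refine isMultiplicityFree_of_minimal hc (fun i => ⟨t i, htM i⟩) (fun i => Subtype.ext (htt i))
    (fun i => ?_) ?_ (fun i j hij => ?_) fun x hx i => ?_
  · rw [hTq]; exact hq i
  · simp only [hTq]
    refine Subtype.ext ?_
    rw [AddSubmonoidClass.coe_finsetSum]
    simp only [hqp]
    exact hsum
  · rw [hTq, hTq]
    refine Subtype.ext ?_
    change (q i : H →L[ℂ] H) * (q j : H →L[ℂ] H) = 0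
    rw [hqp, hqp, horth i j hij]
  · obtain ⟨c, hc⟩ := hmin x (mem_homAlgebra_iff.2 ⟨x, hx, rfl⟩) i
    refine ⟨c, ?_⟩
    rw [hTq]
    refine Subtype.ext ?_
    change (x : H →L[ℂ] H) * (q i : H →L[ℂ] H) = c • (q i : H →L[ℂ] H)
    rw [hqp, hc]

end FactorEndomorphisms

end Subfactor

open Subfactor in
theorem propositionp {H : Type*} [NormedAddCommGroup H] [InnerProductSpace ℂ H]
    [CompleteSpace H] [TopologicalSpace.SeparableSpace H]
    (N M : VonNeumannAlgebra H) (hN : IsTypeIIIFactor N) (hM : IsTypeIIIFactor M) (hNM : N ≤ M)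
    (ιbar : M.toStarSubalgebra →⋆ₐ[ℂ] N.toStarSubalgebra)
    (w : Hom (StarAlgHom.id ℂ N.toStarSubalgebra) (dualCanonicalEnd (embedding hNM) ιbar))
    (v : Hom (StarAlgHom.id ℂ M.toStarSubalgebra) (canonicalEnd (embedding hNM) ιbar))
    (hwv : IsStandardSolution (embedding hNM) ιbar w v) :
    ((∀ t₁ t₂ : Hom (dualCanonicalEnd (embedding hNM) ιbar)
          (dualCanonicalEnd (embedding hNM) ιbar),
        convolution w v t₁ t₂ = convolution w v t₂ t₁) ↔
      (∀ s₁ s₂ : Hom (canonicalEnd (embedding hNM) ιbar) (canonicalEnd (embedding hNM) ιbar),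
        comp s₁ s₂ = comp s₂ s₁)) ∧
    ((∀ s₁ s₂ : Hom (canonicalEnd (embedding hNM) ιbar) (canonicalEnd (embedding hNM) ιbar),
        comp s₁ s₂ = comp s₂ s₁) →
      IsMultiplicityFree (canonicalEnd (embedding hNM) ιbar)) ∧
    (∀ (𝒞 : BraidedFullSubcategory N.toStarSubalgebra)
        (hθ : dualCanonicalEnd (embedding hNM) ιbar ∈ 𝒞.obj),
      IsCommutativeQSystem 𝒞 hθ v →
        (∀ t₁ t₂ : Hom (dualCanonicalEnd (embedding hNM) ιbar)
            (dualCanonicalEnd (embedding hNM) ιbar),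
          convolution w v t₁ t₂ = convolution w v t₂ t₁) ∧
        (∀ s₁ s₂ : Hom (canonicalEnd (embedding hNM) ιbar) (canonicalEnd (embedding hNM) ιbar),
          comp s₁ s₂ = comp s₂ s₁) ∧
        IsMultiplicityFree (canonicalEnd (embedding hNM) ιbar)) := by
  obtain ⟨h, d, hd, -⟩ := hwv
  have hmult := isMultiplicityFree_canonicalEnd hM h hd
  refine ⟨convolution_comm_iff h, hmult, fun 𝒞 hθ hQ => ?_⟩
  have hconv := convolution_comm_of_isCommutativeQSystem h 𝒞 hθ hQ
  have hγ := (convolution_comm_iff h).1 hconv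
  exact ⟨hconv, hγ, hmult hγ⟩
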